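/- Let $\langle f,g\rangle=\int_{-1}^1 fg\,dt$. Let $p_i^{5/2}$ be the monic polynomial of degree $i$ that is orthogonal on $[-1,1]$, for the weight $(1-t)^2(1+t)^2$, to all polynomials of lower degree, and put $\phi^0_j(t)=(1-t^2)\,p^{5/2}_{j-2}(t)$ for $j\ge 2$. For $N\ge 2$ let $P^N$ be the orthogonal projection of $L^2[-1,1]$ onto the span of $\phi^0_2,\dots,\phi^0_N$ (the polynomials of degree at most $N$ that vanish at $\pm1$); the $\phi^0_j$ are an orthogonal basis of this space. On $[-1,1]$ set $r_0^N=(I-P^N)(1+t)$, $l_0^N(t)=r_0^N(-t)$, and, for $1\le m\le N$, $u^0_{N,N-m}=(I-P^N)\bar u_m$, where $\bar u_m(t)=1-|t|t^{m-1}$ if $m$ is odd and $\bar u_m(t)=t-|t|t^{m-1}$ if $m$ is even. Fix $n\ge1$, let $w=w^0_{4n,2n}=u^0_{4n,2n}$, and $$q_{r}=r_0^{4n}-\frac{\langle w,r_0^{4n}\rangle}{\langle w,w\rangle}\,w,\qquad q_{l}(t)=q_{r}(-t).$$ Define functions on $\mathbb R$, equal to $0$ where not specified, by $\tilde\phi_j(t)=\phi^0_j(2t-1)$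 on $[0,1)$ for $2\le j\le 4n$; $\tilde\phi_1(t)=w(2t-1)$ on $[0,1)$; and $\tilde\phi_0(t)=q_r(2t+1)$ on $[-1,0)$, $\tilde\phi_0(t)=q_l(2t-1)$ on $[0,1)$. Let $\Phi_{4n}=(\tilde\phi_0,\dots,\tilde\phi_{4n})^T$, let $V_0$ be the closed linear span in $L^2(\mathbb R)$ of $\{\tilde\phi_i(\cdot-j):0\le i\le 4n,\ j\in\mathbb Z\}$, and $V_p=\{f(2^p\cdot):f\in V_0\}$ for $p\in\mathbb Z$. Let $V_p^{4n,0}=\{f(2^p\cdot): f\in V_0^{4n,0}\}$, where $V_0^{4n,0}$ is the space of continuous functions in $L^2(\mathbb R)$ that are polynomials of degree at most $4n$ on each interval $[k,k+1]$, $k\in\mathbb Z$. **Theorem.** For every $n\ge1$: 1. The $\tilde\phi_i$ are compactly supported functions in $L^2(\mathbb R)$, and $\Phi_{4n}$ generates an orthogonal multiresolution analysis $(V_p)_{p\in\mathbb Z}$: $V_p\subset V_{p+1}$ for all $p$, and the functions $\tilde\phi_i(\cdot-j)$, $0\le i\le 4n$, $j\in\mathbb Z$, form a Riesz basis of $V_0$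 and are pairwise orthogonal. 2. It is intertwined with the continuous spline spaces: $V_p^{4n,0}\subset V_p\subset V_{p+1}^{4n,0}$ for all $p\in\mathbb Z$. 3. $\tilde\phi_0$ is symmetric, $\tilde\phi_0(-t)=\tilde\phi_0(t)$, and each $\tilde\phi_i$ coincides on every interval $[\frac k2,\frac{k+1}2]$, $k\in\mathbb Z$, with a polynomial of degree at most $4n$ with rational coefficients. 4. $\alpha_{0,n}(4n)=0$; that is, $\alpha=0$ is a solution of the equation $$\langle r_0^{4n},l_0^{4n}\rangle\langle w_\alpha,w_\alpha\rangle=\langle r_0^{4n},w_\alpha\rangle\langle w_\alpha,l_0^{4n}\rangle,\qquad w_\alpha=\alpha\,u^0_{4n,0}+u^0_{4n,2n},$$ so that $w_0=u^0_{4n,2n}=w$. -/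

import Mathlib

open MeasureTheory Polynomial

noncomputable section

namespace SplineMRA

/-! ### Finitely generated shift-invariant spaces and multiresolution analyses -/

/-- The Hilbert space `L²(ℝ)` of real-valued functions. -/
abbrev L2R : Type := Lp ℝ 2 (volume : Measure ℝ)

/-- The integer translate `f(· - j)`. -/
def translate (j : ℤ) (f : L2R) : L2R :=
  Lp.compMeasurePreserving (fun t : ℝ => t - (j : ℝ))
    (measurePreserving_sub_right volume (j : ℝ)) f

/-- The set `{f(2^p ·) : f ∈ S}`. -/
def dilate (p : ℤ) (S : Set L2R) : Set L2R :=
  {f | ∃ g ∈ S, ∀ᵐ t : ℝ, f t = g ((2 : ℝ) ^ p * t)}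

/-- All integer translates of the generators. -/
def translates {ι : Type} (G : ι → L2R) : ι × ℤ → L2R :=
  fun k => translate k.2 (G k.1)

/-- `V₀ = cl span {φ^i(· - j)}`. -/
def V₀ {ι : Type} (G : ι → L2R) : Submodule ℝ L2R :=
  (Submodule.span ℝ (Set.range (translates G))).topologicalClosure

/-- `V_p = {φ(2^p ·) : φ ∈ V₀}`. -/
def V {ι : Type} (G : ι → L2R) (p : ℤ) : Set L2R :=
  dilate p (V₀ G : Set L2R)

/-- `e` is a Riesz basis of the closed subspace `W`. -/
def IsRieszBasis {κ : Type} (e : κ → L2R) (W : Submodule ℝ L2R) : Prop :=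
  (Submodule.span ℝ (Set.range e)).topologicalClosure = W ∧
  ∃ A B : ℝ, 0 < A ∧ 0 < B ∧ ∀ c : κ →₀ ℝ,
    A * (c.sum fun _ a => a ^ 2) ≤ ‖c.sum fun k a => a • e k‖ ^ 2 ∧
    ‖c.sum fun k a => a • e k‖ ^ 2 ≤ B * (c.sum fun _ a => a ^ 2)

/-- The spaces `V_p` form a multiresolution analysis generated by `G`. -/
def IsMRA {ι : Type} (G : ι → L2R) : Prop :=
  (∀ p : ℤ, V G p ⊆ V G (p + 1)) ∧ IsRieszBasis (translates G) (V₀ G)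

/-- An MRA whose generators and their integer translates are pairwise orthogonal. -/
def IsOrthogonalMRA {ι : Type} (G : ι → L2R) : Prop :=
  IsMRA G ∧ Pairwise fun k k' => inner ℝ (translates G k) (translates G k') = 0

/-- `S₀^N ∩ L²(ℝ)`: the square integrable continuous functions that are polynomials of degree
at most `N` between consecutive integers. -/
def splineSpace₀ (N : ℕ) : Set L2R :=
  {f | ∃ s : ℝ → ℝ, Continuous s ∧
    (∀ k : ℤ, ∃ P : ℝ[X], P.natDegree ≤ N ∧
      ∀ t ∈ Set.Icc (k : ℝ) (k + 1), s t = P.eval t) ∧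
    ∀ᵐ t : ℝ, f t = s t}

/-- The dilated spline spaces `V_p^{N,0}`. -/
def splineSpace (N : ℕ) (p : ℤ) : Set L2R := dilate p (splineSpace₀ N)

/-! ### Orthogonal polynomials on `[-1,1]` -/

/-- Monic orthogonal polynomials on `[-1,1]` for the weight `w` (Gram–Schmidt on monomials). -/
def monicOrtho (w : ℝ → ℝ) : ℕ → ℝ[X]
  | n => X ^ n - ∑ i : Fin n,
      C ((∫ t in (-1 : ℝ)..1, t ^ n * (monicOrtho w i).eval t * w t) /
          (∫ t in (-1 : ℝ)..1, (monicOrtho w i).eval t ^ 2 * w t)) * monicOrtho w i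
  decreasing_by all_goals exact i.2

/-- The monic Jacobi polynomial `p_n^{α,β}`. -/
def monicJacobi (α β : ℝ) (n : ℕ) : ℝ[X] :=
  monicOrtho (fun t => (1 - t) ^ α * (1 + t) ^ β) n

/-- The monic ultraspherical polynomial `p_n^{lam}`. -/
def monicUltraspherical (lam : ℝ) (n : ℕ) : ℝ[X] :=
  monicJacobi (lam - 1 / 2) (lam - 1 / 2) n

/-! ### The functions on `[-1,1]` from which the generators are built -/

/-- The inner product of `L²[-1,1]`. -/
def ip (f g : ℝ → ℝ) : ℝ := ∫ t in (-1 : ℝ)..1, f t * g t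

/-- The bubble functions `φ_j^0(t) = (1 - t²) p_{j-2}^{5/2}(t)`, `j ≥ 2`. -/
def bubble (j : ℕ) (t : ℝ) : ℝ :=
  if 2 ≤ j then (1 - t ^ 2) * (monicUltraspherical (5 / 2) (j - 2)).eval t else 0

/-- `(I - P^N) f`, where `P^N` is the orthogonal projection in `L²[-1,1]` onto the space of
polynomials of degree at most `N` vanishing at `±1`, written in its orthogonal basis
`φ_2^0, …, φ_N^0`. -/
def residual (N : ℕ) (f : ℝ → ℝ) (t : ℝ) : ℝ :=
  f t - ∑ j ∈ Finset.Icc 2 N, ip f (bubble j) / ip (bubble j) (bubble j) * bubble j t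

/-- The ramp `r_0^N = (I - P^N)(1 + t)`. -/
def rampR (N : ℕ) : ℝ → ℝ := residual N fun t => 1 + t

/-- The reflected ramp `l_0^N(t) = r_0^N(-t)`. -/
def rampL (N : ℕ) (t : ℝ) : ℝ := rampR N (-t)

/-- `ū_m`, for `m ≥ 1`. -/
def uBar (m : ℕ) (t : ℝ) : ℝ :=
  if t ∈ Set.Icc (-1 : ℝ) 1 then (if Odd m then 1 else t) - |t| * t ^ (m - 1) else 0

/-- `u^0_{N,k} = (I - P^N) ū_{N-k}`, for `k < N`. -/
def u (N k : ℕ) : ℝ → ℝ := residual N (uBar (N - k))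

/-- `w^0_{N,m,m₁} = a u^0_{N,2m} + u^0_{N,2m₁}`, where the number `a` is the candidate
for `α_{m,m₁}(N)`. -/
def wGen (N m m₁ : ℕ) (a : ℝ) (t : ℝ) : ℝ := a * u N (2 * m) t + u N (2 * m₁) t

/-- The quadratic equation in `a` that defines `α_{m,m₁}(N)`:
`⟨r_0^N, l_0^N⟩ ⟨w, w⟩ = ⟨r_0^N, w⟩ ⟨w, l_0^N⟩` for `w = a u^0_{N,2m} + u^0_{N,2m₁}`. -/
def IsIntertwiningCoeff (N m m₁ : ℕ) (a : ℝ) : Prop :=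
  ip (rampR N) (rampL N) * ip (wGen N m m₁ a) (wGen N m m₁ a) =
    ip (rampR N) (wGen N m m₁ a) * ip (wGen N m m₁ a) (rampL N)

/-- `q_{r_0^N} = (I - P_w) r_0^N`, with `P_w` the orthogonal projection onto the span of `w`. -/
def qR (N : ℕ) (w : ℝ → ℝ) (t : ℝ) : ℝ := rampR N t - ip w (rampR N) / ip w w * w t

/-- `q_{l_0^N}(t) = q_{r_0^N}(-t)`. -/
def qL (N : ℕ) (w : ℝ → ℝ) (t : ℝ) : ℝ := qR N w (-t)

/-- The vector `(φ̃_0, …, φ̃_N)` built from `w`. -/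
def scalingVector (N : ℕ) (w : ℝ → ℝ) (j : Fin (N + 1)) (t : ℝ) : ℝ :=
  if j.val = 0 then
    if -1 ≤ t ∧ t < 0 then qR N w (2 * t + 1)
    else if 0 ≤ t ∧ t < 1 then qL N w (2 * t - 1)
    else 0
  else if j.val = 1 then
    if 0 ≤ t ∧ t < 1 then w (2 * t - 1) else 0
  else
    if 0 ≤ t ∧ t < 1 then bubble j.val (2 * t - 1) else 0

/-- `Φ_{4n}`, built from `w^0_{4n,2n} = u^0_{4n,2n}`. -/
def Phi (n : ℕ) : Fin (4 * n + 1) → ℝ → ℝ := scalingVector (4 * n) (u (4 * n) (2 * n))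

end SplineMRA

end

open SplineMRA

open MeasureTheory Polynomial

noncomputable section

/-! Everything reduces to one identity, `⟨q_r, q_l⟩ = 0` (`ip_qR_qL`); the other orthogonality
relations hold by construction of the residuals.

Since `w` is odd, `q_r = E + O` on `[-1,1]`, where `E` lies in the span of the even monomials of
degree at most `4n`, and `O` in the span of the odd ones together with `|t| t^(2n-1)`. As `q_r`
takes the values 2 and 0 at `1` and `-1`, both components equal 1 at `1`. Now `q_l = E - O`, so the
claim is `⟨E, E⟩ = ⟨O, O⟩`. Because `q_r` is orthogonal to `w` and to all polynomials of degree at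
most `4n` vanishing at `±1`, it has the same inner product with every basis function of the even
family, and likewise for the odd family. Thus the coefficient vector of each component has total
mass one and is sent to a constant vector by the Gram matrix, and that constant is the squared norm
of the component.

On `[0,1]` the Gram matrix of monomials with exponents `l_i` is `G = (1/(l_i + l_j + 1))`. It
satisfies `DG + GD + G = J`, with `D = diag(l_i)` and `J` the all-ones matrix; multiplying by `G⁻¹`
and taking traces shows that the sum of the entries of `G⁻¹` is `∑ (2 l_i + 1)`
(`gram_constant_mul_sum`). The exponent `2n` is the one for which this sum is the same for both
families (`sum_odd_exponents`).

For the function spaces, only two translates of each generator meet a given unit interval, so `V₀`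
consists of the square integrable sums of locally finite series of translates
(`ae_eq_series_of_mem_V₀`, `mem_V₀_of_ae_eq_series`). A spline is such a series because on each unit
interval it is a combination of the generator pieces, with its nodal values as coefficients of the
symmetric generator; conversely the generators are continuous with breakpoints at half-integers.
Nestedness follows from this intertwining. Rationality holds because every projection coefficient is
a quotient of integrals of piecewise rational polynomials. -/

namespace SplineMRA

/-! ### Locally finite series of integer translates -/

section Series

variable {ι : Type} [Fintype ι] {φ : ι → ℝ → ℝ}

/-- The series `∑ a_{i,j} φ_i(· - j)` of translates of the functions `φ_i`. -/
def series (φ : ι → ℝ → ℝ) (a : ι × ℤ → ℝ) (t : ℝ) : ℝ :=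
  ∑ᶠ k : ι × ℤ, a k * φ k.1 (t - k.2)

theorem series_eq_sum (hs : ∀ i x, 1 ≤ |x| → φ i x = 0) (a : ι × ℤ → ℝ) (J : Finset ℤ) {t : ℝ}
    (ht : ∀ j : ℤ, j ∉ J → 1 ≤ |t - j|) :
    series φ a t = ∑ k ∈ Finset.univ ×ˢ J, a k * φ k.1 (t - k.2) := by
  refine finsum_eq_sum_of_support_subset _ fun k hk => ?_
  by_contra hkJ
  refine hk ?_
  have : k.2 ∉ J := by simpa using hkJ
  simp [hs k.1 _ (ht k.2 this)]

theorem one_le_abs_sub_of_mem_Icc {k j : ℤ} {t : ℝ} (ht : t ∈ Set.Icc (k : ℝ) (k + 1))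
    (hj : j ∉ ({k, k + 1} : Finset ℤ)) : 1 ≤ |t - j| := by
  simp only [Finset.mem_insert, Finset.mem_singleton, not_or] at hj
  rcases lt_or_gt_of_ne hj.1 with h | h
  · have : (j : ℝ) + 1 ≤ k := by exact_mod_cast h
    rw [le_abs]; left; linarith [ht.1]
  · have h' : k + 1 + 1 ≤ j := by omega
    have : (k : ℝ) + 1 + 1 ≤ j := by exact_mod_cast h'
    rw [le_abs]; right; linarith [ht.2]

theorem one_le_abs_sub_of_abs_sub_lt {k j : ℤ} {t : ℝ} (ht : |t - k| < 1)
    (hj : j ∉ Finset.Icc (k - 1) (k + 1)) : 1 ≤ |t - j| := by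
  simp only [Finset.mem_Icc, not_and, not_le] at hj
  rw [abs_lt] at ht
  by_cases h : k - 1 ≤ j
  · have h' : k + 1 + 1 ≤ j := hj h
    have : (k : ℝ) + 1 + 1 ≤ j := by exact_mod_cast h'
    rw [le_abs]; right; linarith [ht.2]
  · have h' : j + 1 ≤ k - 1 := by omega
    have : (j : ℝ) + 1 ≤ k - 1 := by exact_mod_cast h'
    rw [le_abs]; left; linarith [ht.1]

theorem continuous_series (hc : ∀ i, Continuous (φ i)) (hs : ∀ i x, 1 ≤ |x| → φ i x = 0)
    (a : ι × ℤ → ℝ) : Continuous (series φ a) := by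
  refine continuous_finsum (fun k => ?_) fun x => ?_
  · exact continuous_const.mul ((hc k.1).comp (continuous_id.sub continuous_const))
  · obtain ⟨m, hm⟩ : ∃ m : ℤ, |x - m| < 1 :=
      ⟨⌊x⌋, by rw [abs_lt]; constructor <;> linarith [Int.floor_le x, Int.lt_floor_add_one x]⟩
    have hU : {t : ℝ | |t - m| < 1} ∈ nhds x :=
      (isOpen_lt (continuous_abs.comp (continuous_id.sub continuous_const))
        continuous_const).mem_nhds hm
    -- Within distance 1 of `m`, only the translates by `m - 1`, `m`, `m + 1` can be nonzero.
    refine ⟨_, hU,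
      ((Finset.univ ×ˢ Finset.Icc (m - 1) (m + 1) : Finset (ι × ℤ)).finite_toSet).subset ?_⟩
    rintro k ⟨t, ht, htm⟩
    by_contra hk
    have hk' : k.2 ∉ Finset.Icc (m - 1) (m + 1) := by simpa using hk
    exact ht (by simp [hs k.1 _ (one_le_abs_sub_of_abs_sub_lt htm hk')])

end Series

/-! ### Shift-invariant spaces with orthogonal continuous generators -/

section Abstract

variable {ι : Type} {φ : ι → ℝ → ℝ} (hφ : ∀ i, MemLp (φ i) 2 (volume : Measure ℝ))

theorem translates_toLp_coeFn (k : ι × ℤ) :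
    ∀ᵐ t : ℝ, translates (fun i => (hφ i).toLp (φ i)) k t = φ k.1 (t - k.2) := by
  have h1 := Lp.coeFn_compMeasurePreserving ((hφ k.1).toLp (φ k.1))
    (measurePreserving_sub_right volume (k.2 : ℝ))
  have h2 := (measurePreserving_sub_right volume (k.2 : ℝ)).quasiMeasurePreserving.ae_eq_comp
    (hφ k.1).coeFn_toLp
  filter_upwards [h1, h2] with t h1 h2
  exact h1.trans h2

theorem norm_translates (G : ι → L2R) (k : ι × ℤ) : ‖translates G k‖ = ‖G k.1‖ :=
  Lp.norm_compMeasurePreserving _ _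

/-- The Fourier coefficient of `f` with respect to `e`. -/
def fourierCoeff (e f : L2R) : ℝ := (‖e‖ ^ 2)⁻¹ * inner ℝ e f

theorem sum_coeFn {κ : Type} (S : Finset κ) (a : κ → ℝ) (e : κ → L2R) (g : κ → ℝ → ℝ)
    (h : ∀ k, ∀ᵐ t : ℝ, e k t = g k t) :
    ∀ᵐ t : ℝ, (∑ k ∈ S, a k • e k : L2R) t = ∑ k ∈ S, a k * g k t := by
  classical
  induction S using Finset.induction_on with
  | empty =>
    filter_upwards [Lp.coeFn_zero ℝ 2 (volume : Measure ℝ)] with t ht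
    simp
  | insert k S hk ih =>
    rw [Finset.sum_insert hk]
    filter_upwards [Lp.coeFn_add (a k • e k) (∑ k ∈ S, a k • e k), Lp.coeFn_smul (a k) (e k), ih,
      h k] with t h1 h2 h3 h4
    rw [h1, Pi.add_apply, h2, Pi.smul_apply, h3, h4, Finset.sum_insert hk, smul_eq_mul]

theorem ae_of_forall_Ico {p : ℝ → Prop}
    (h : ∀ k : ℤ, ∀ᵐ t : ℝ ∂(volume.restrict (Set.Ico (k : ℝ) (k + 1))), p t) : ∀ᵐ t : ℝ, p t := by
  have := (ae_restrict_iUnion_iff (μ := (volume : Measure ℝ))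
    (fun k : ℤ => Set.Ico (k : ℝ) (k + 1)) p).2 h
  rwa [iUnion_Ico_intCast, Measure.restrict_univ] at this

theorem fourierCoeff_sum
    (hne : ∀ i, (hφ i).toLp (φ i) ≠ 0)
    (horth : Pairwise fun k k' =>
      inner ℝ (translates (fun i => (hφ i).toLp (φ i)) k)
        (translates (fun i => (hφ i).toLp (φ i)) k') = 0)
    (S : Finset (ι × ℤ)) (a : ι × ℤ → ℝ) {m : ι × ℤ} (hm : m ∈ S) :
    fourierCoeff (translates (fun i => (hφ i).toLp (φ i)) m)
      (∑ k ∈ S, a k • translates (fun i => (hφ i).toLp (φ i)) k) = a m := by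
  have h0 : ‖translates (fun i => (hφ i).toLp (φ i)) m‖ ^ 2 ≠ 0 := by
    rw [norm_translates]; exact pow_ne_zero 2 (norm_ne_zero_iff.2 (hne m.1))
  rw [fourierCoeff, inner_sum, Finset.sum_eq_single m, inner_smul_right,
    real_inner_self_eq_norm_sq]
  · rw [mul_left_comm, inv_mul_cancel₀ h0, mul_one]
  · intro k _ hk
    rw [inner_smul_right, horth hk.symm, mul_zero]
  · exact fun h => absurd hm h

variable [Fintype ι]

/-- On `[m, m+1)` only the translates by `m` and `m + 1` survive. Subtracting their Fourier terms
and restricting to this interval is a continuous operator that kills every translate, hence the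
closed span. -/
theorem ae_eq_series_of_mem_V₀ (hs : ∀ i x, 1 ≤ |x| → φ i x = 0)
    (hne : ∀ i, (hφ i).toLp (φ i) ≠ 0)
    (horth : Pairwise fun k k' =>
      inner ℝ (translates (fun i => (hφ i).toLp (φ i)) k)
        (translates (fun i => (hφ i).toLp (φ i)) k') = 0)
    {f : L2R} (hf : f ∈ V₀ fun i => (hφ i).toLp (φ i)) :
    ∀ᵐ t : ℝ, f t = series φ
      (fun k => fourierCoeff (translates (fun i => (hφ i).toLp (φ i)) k) f) t := by
  classical
  set e := translates (fun i => (hφ i).toLp (φ i)) with he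
  refine ae_of_forall_Ico fun m => ?_
  set S : Finset (ι × ℤ) := Finset.univ ×ˢ {m, m + 1} with hS
  set R : L2R →L[ℝ] L2R := ContinuousLinearMap.id ℝ L2R -
    ∑ k ∈ S, (‖e k‖ ^ 2)⁻¹ • (innerSL ℝ (e k)).smulRight (e k) with hR
  have hRf : ∀ g, R g = g - ∑ k ∈ S, fourierCoeff (e k) g • e k := by
    intro g
    simp [hR, fourierCoeff, smul_smul]
  set T := (LpToLpRestrictCLM ℝ ℝ ℝ volume 2 (Set.Ico (m : ℝ) (m + 1))).comp R with hT
  have hker : V₀ (fun i => (hφ i).toLp (φ i)) ≤ T.ker := by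
    refine Submodule.topologicalClosure_minimal _ ?_ T.isClosed_ker
    rw [Submodule.span_le]
    rintro _ ⟨k, rfl⟩
    change T (e k) = 0
    rw [hT, ContinuousLinearMap.comp_apply, hRf]
    by_cases hk : k ∈ S
    · have : ∑ k' ∈ S, fourierCoeff (e k') (e k) • e k' = e k := by
        rw [Finset.sum_eq_single k]
        · have := fourierCoeff_sum hφ hne horth {k} (fun _ => 1) (Finset.mem_singleton_self k)
          simp only [Finset.sum_singleton, one_smul] at this
          rw [← he] at this
          rw [this, one_smul]
        · intro k' _ hk'
          rw [fourierCoeff, horth hk', mul_zero, zero_smul]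
        · exact fun h => absurd hk h
      rw [this, sub_self, map_zero]
    · have : ∑ k' ∈ S, fourierCoeff (e k') (e k) • e k' = 0 := by
        refine Finset.sum_eq_zero fun k' hk' => ?_
        rw [fourierCoeff, horth (show k' ≠ k from fun h => hk (h ▸ hk')), mul_zero, zero_smul]
      rw [this, sub_zero, Lp.eq_zero_iff_ae_eq_zero]
      filter_upwards [LpToLpRestrictCLM_coeFn ℝ (Set.Ico (m : ℝ) (m + 1)) (e k),
        ae_restrict_of_ae (translates_toLp_coeFn hφ k), ae_restrict_mem measurableSet_Ico]
        with t h1 h2 h3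
      rw [h1, h2]
      refine hs _ _ (one_le_abs_sub_of_mem_Icc (Set.Ico_subset_Icc_self h3) ?_)
      simpa [hS] using hk
  have hTf : T f = 0 := hker hf
  rw [hT, ContinuousLinearMap.comp_apply, hRf, Lp.eq_zero_iff_ae_eq_zero] at hTf
  filter_upwards [hTf, LpToLpRestrictCLM_coeFn ℝ (Set.Ico (m : ℝ) (m + 1))
      (f - ∑ k ∈ S, fourierCoeff (e k) f • e k),
    ae_restrict_of_ae (Lp.coeFn_sub f (∑ k ∈ S, fourierCoeff (e k) f • e k)),
    ae_restrict_of_ae (sum_coeFn S (fun k => fourierCoeff (e k) f) e _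
      (translates_toLp_coeFn hφ)),
    ae_restrict_mem measurableSet_Ico] with t h1 h2 h3 h4 h5
  rw [h2, h3, Pi.sub_apply, h4, Pi.zero_apply, sub_eq_zero] at h1
  rw [h1, series_eq_sum hs _ {m, m + 1}]
  exact fun j hj => one_le_abs_sub_of_mem_Icc (Set.Ico_subset_Icc_self h5) hj

/-- The support of one translate meets only finitely many terms of the series, so its inner product
with `f` is that with a finite sum. -/
theorem fourierCoeff_of_ae_eq_series (hs : ∀ i x, 1 ≤ |x| → φ i x = 0)
    (hne : ∀ i, (hφ i).toLp (φ i) ≠ 0)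
    (horth : Pairwise fun k k' =>
      inner ℝ (translates (fun i => (hφ i).toLp (φ i)) k)
        (translates (fun i => (hφ i).toLp (φ i)) k') = 0)
    {f : L2R} {b : ι × ℤ → ℝ}
    (hf : ∀ᵐ t : ℝ, f t = series φ b t) (m : ι × ℤ) :
    fourierCoeff (translates (fun i => (hφ i).toLp (φ i)) m) f = b m := by
  set e := translates (fun i => (hφ i).toLp (φ i)) with he
  set J := Finset.Icc (m.2 - 1) (m.2 + 1)
  have hm : m ∈ (Finset.univ ×ˢ J : Finset (ι × ℤ)) := by simp [J]
  rw [← fourierCoeff_sum hφ hne horth _ b hm, fourierCoeff, fourierCoeff]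
  congr 1
  rw [L2.inner_def, L2.inner_def]
  refine integral_congr_ae ?_
  filter_upwards [hf, translates_toLp_coeFn hφ m,
    sum_coeFn (Finset.univ ×ˢ J) b e _ (translates_toLp_coeFn hφ)] with t h1 h2 h3
  rw [h1, h2]
  by_cases ht : 1 ≤ |t - m.2|
  · simp [hs _ _ ht]
  · congr 1
    rw [h3, series_eq_sum hs b J]
    exact fun j hj => one_le_abs_sub_of_abs_sub_lt (not_le.1 ht) hj

/-- No convergence of the series in norm has to be shown: the orthogonal projection of `f` onto `V₀`
has the same Fourier coefficients as `f`, so it is the sum of the same series and coincides with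
`f`. -/
theorem mem_V₀_of_ae_eq_series (hs : ∀ i x, 1 ≤ |x| → φ i x = 0)
    (hne : ∀ i, (hφ i).toLp (φ i) ≠ 0)
    (horth : Pairwise fun k k' =>
      inner ℝ (translates (fun i => (hφ i).toLp (φ i)) k)
        (translates (fun i => (hφ i).toLp (φ i)) k') = 0)
    {f : L2R} {b : ι × ℤ → ℝ}
    (hf : ∀ᵐ t : ℝ, f t = series φ b t) : f ∈ V₀ fun i => (hφ i).toLp (φ i) := by
  set W := V₀ fun i => (hφ i).toLp (φ i) with hW
  have : CompleteSpace W := (Submodule.isClosed_topologicalClosure _).completeSpace_coe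
  set g : L2R := W.starProjection f with hg
  have hgW : g ∈ W := Submodule.starProjection_apply_mem W f
  have hco : (fun k => fourierCoeff (translates (fun i => (hφ i).toLp (φ i)) k) g) = b := by
    funext m
    rw [← fourierCoeff_of_ae_eq_series hφ hs hne horth hf m, fourierCoeff, fourierCoeff]
    congr 1
    have hmem : translates (fun i => (hφ i).toLp (φ i)) m ∈ W :=
      Submodule.le_topologicalClosure _ (Submodule.subset_span ⟨m, rfl⟩)
    have := Submodule.starProjection_inner_eq_zero f _ hmem
    rw [inner_sub_left, sub_eq_zero] at this
    rw [real_inner_comm, ← this, real_inner_comm]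
  have hg' := ae_eq_series_of_mem_V₀ hφ hs hne horth hgW
  rw [hco] at hg'
  have : f = g := by
    refine Lp.ext ?_
    filter_upwards [hf, hg'] with t h1 h2
    rw [h1, h2]
  rw [this]
  exact hgW

theorem isRieszBasis_translates
    (hne : ∀ i, (hφ i).toLp (φ i) ≠ 0)
    (horth : Pairwise fun k k' =>
      inner ℝ (translates (fun i => (hφ i).toLp (φ i)) k)
        (translates (fun i => (hφ i).toLp (φ i)) k') = 0)
    [Nonempty ι] :
    IsRieszBasis (translates fun i => (hφ i).toLp (φ i)) (V₀ fun i => (hφ i).toLp (φ i)) := by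
  set e := translates (fun i => (hφ i).toLp (φ i)) with he
  refine ⟨rfl, ?_⟩
  obtain ⟨i₀, hi₀⟩ := Finite.exists_min fun i => ‖(hφ i).toLp (φ i)‖
  obtain ⟨i₁, hi₁⟩ := Finite.exists_max fun i => ‖(hφ i).toLp (φ i)‖
  refine ⟨‖(hφ i₀).toLp (φ i₀)‖ ^ 2, ‖(hφ i₁).toLp (φ i₁)‖ ^ 2, pow_pos (norm_pos_iff.2 (hne _)) 2,
    pow_pos (norm_pos_iff.2 (hne _)) 2, fun c => ?_⟩
  -- Pythagoras; the Riesz bounds are then the extreme squared norms of the finitely many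
  -- generators, since translation preserves norms.
  have key : ‖c.sum fun k a => a • e k‖ ^ 2 = c.sum fun k a => a ^ 2 * ‖e k‖ ^ 2 := by
    rw [← real_inner_self_eq_norm_sq, Finsupp.sum, Finsupp.sum, sum_inner]
    refine Finset.sum_congr rfl fun k hk => ?_
    rw [inner_sum, Finset.sum_eq_single k]
    · rw [inner_smul_left, inner_smul_right, real_inner_self_eq_norm_sq]
      simp; ring
    · intro k' _ hk'
      rw [inner_smul_left, inner_smul_right, horth hk'.symm, mul_zero, mul_zero]
    · exact fun h => absurd hk h
  rw [key, Finsupp.sum, Finsupp.sum, Finset.mul_sum, Finset.mul_sum]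
  constructor
  · refine Finset.sum_le_sum fun k _ => ?_
    rw [he, norm_translates, mul_comm]
    gcongr
    exact hi₀ _
  · refine Finset.sum_le_sum fun k _ => ?_
    rw [he, norm_translates, mul_comm]
    gcongr
    exact hi₁ _

end Abstract

/-! ### Dilations -/

theorem ae_comp_mul_left {c : ℝ} (hc : c ≠ 0) {p : ℝ → Prop} (h : ∀ᵐ t : ℝ, p t) :
    ∀ᵐ t : ℝ, p (c * t) := by
  have hq : Measure.QuasiMeasurePreserving (fun t : ℝ => c * t) volume volume := by
    refine ⟨measurable_const_mul c, ?_⟩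
    rw [Real.map_volume_mul_left hc]
    exact Measure.smul_absolutelyContinuous
  exact hq.ae h

theorem memLp_comp_mul_left {c : ℝ} (hc : c ≠ 0) {f : ℝ → ℝ} (hf : MemLp f 2 volume) :
    MemLp (fun t => f (c * t)) 2 volume := by
  have hm : AEMeasurable (fun t : ℝ => c * t) volume := (measurable_const_mul c).aemeasurable
  have h := hf.smul_measure (c := ENNReal.ofReal |c⁻¹|) ENNReal.ofReal_ne_top
  rw [← Real.map_volume_mul_left hc] at h
  exact (memLp_map_measure_iff h.1 hm).1 h

theorem dilate_mono (p : ℤ) {S T : Set L2R} (h : S ⊆ T) : dilate p S ⊆ dilate p T :=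
  fun _ ⟨g, hg, hfg⟩ => ⟨g, h hg, hfg⟩

theorem dilate_dilate_one (p : ℤ) (S : Set L2R) : dilate p (dilate 1 S) ⊆ dilate (p + 1) S := by
  rintro f ⟨g, ⟨h, hh, hgh⟩, hfg⟩
  refine ⟨h, hh, ?_⟩
  have h2 : (2 : ℝ) ^ p ≠ 0 := zpow_ne_zero _ two_ne_zero
  filter_upwards [hfg, ae_comp_mul_left h2 hgh] with t h1 h3
  rw [h1, h3, zpow_add₀ two_ne_zero, zpow_one, ← mul_assoc, mul_comm (2 : ℝ) ((2 : ℝ) ^ p)]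

section Intertwining

variable {ι : Type} [Fintype ι] {φ : ι → ℝ → ℝ} (hφ : ∀ i, MemLp (φ i) 2 (volume : Measure ℝ))

theorem V₀_subset_dilate_splineSpace₀ (hc : ∀ i, Continuous (φ i))
    (hs : ∀ i x, 1 ≤ |x| → φ i x = 0)
    (hne : ∀ i, (hφ i).toLp (φ i) ≠ 0)
    (horth : Pairwise fun k k' =>
      inner ℝ (translates (fun i => (hφ i).toLp (φ i)) k)
        (translates (fun i => (hφ i).toLp (φ i)) k') = 0) {N : ℕ}
    (hpoly : ∀ i, ∀ k : ℤ, ∃ P : ℝ[X], P.natDegree ≤ N ∧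
      ∀ t ∈ Set.Icc ((k : ℝ) / 2) (((k : ℝ) + 1) / 2), φ i t = P.eval t) :
    (V₀ (fun i => (hφ i).toLp (φ i)) : Set L2R) ⊆ dilate 1 (splineSpace₀ N) := by
  intro f hf
  have hfs := ae_eq_series_of_mem_V₀ hφ hs hne horth hf
  set a := fun k => fourierCoeff (translates (fun i => (hφ i).toLp (φ i)) k) f
  have h2 : (2 : ℝ)⁻¹ ≠ 0 := by norm_num
  have hmem : MemLp (fun t : ℝ => f (2⁻¹ * t)) 2 volume := memLp_comp_mul_left h2 (Lp.memLp f)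
  refine ⟨hmem.toLp _, ⟨fun t => series φ a (2⁻¹ * t), ?_, fun k => ?_, ?_⟩, ?_⟩
  · exact (continuous_series hc hs a).comp (continuous_const.mul continuous_id)
  · choose P hPd hP using hpoly
    -- Floor division: `[k/2, (k+1)/2]` lies in the single unit interval `[m, m+1]`.
    set m : ℤ := k / 2
    have hm1 : (m : ℝ) ≤ (k : ℝ) / 2 := by
      have : 2 * m ≤ k := by omega
      have : 2 * (m : ℝ) ≤ k := by exact_mod_cast this
      linarith
    have hm2 : ((k : ℝ) + 1) / 2 ≤ m + 1 := by
      have : k + 1 ≤ 2 * m + 2 := by omega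
      have : (k : ℝ) + 1 ≤ 2 * m + 2 := by exact_mod_cast this
      linarith
    -- Translating by `q.2` shifts the half-integer grid by `2 * q.2` cells, hence the piece of
    -- index `k - 2 * q.2`.
    refine ⟨∑ q ∈ Finset.univ ×ˢ {m, m + 1},
      C (a q) * (P q.1 (k - 2 * q.2)).comp (C 2⁻¹ * X - C (q.2 : ℝ)), ?_, fun t ht => ?_⟩
    · refine natDegree_sum_le_of_forall_le _ _ fun q _ => (natDegree_C_mul_le _ _).trans ?_
      refine natDegree_comp_le.trans ?_
      have : (C (2⁻¹ : ℝ) * X - C (q.2 : ℝ)).natDegree ≤ 1 := by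
        refine (natDegree_sub_le _ _).trans ?_
        simp only [natDegree_C, max_le_iff, zero_le, and_true]
        exact (natDegree_C_mul_le _ _).trans natDegree_X_le
      calc _ ≤ N * 1 := Nat.mul_le_mul (hPd _ _) this
        _ = N := mul_one N
    · have ht' : (2 : ℝ)⁻¹ * t ∈ Set.Icc (m : ℝ) (m + 1) := by
        constructor <;> linarith [ht.1, ht.2]
      simp only
      rw [series_eq_sum hs a {m, m + 1} fun j hj => one_le_abs_sub_of_mem_Icc ht' hj,
        eval_finsetSum]
      refine Finset.sum_congr rfl fun q _ => ?_
      rw [hP q.1 (k - 2 * q.2)]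
      · simp
      · push_cast
        constructor <;> linarith [ht.1, ht.2]
  · filter_upwards [hmem.coeFn_toLp, ae_comp_mul_left h2 hfs] with t h1 h3
    rw [h1, h3]
  · have := ae_comp_mul_left (two_ne_zero (α := ℝ)) hmem.coeFn_toLp
    filter_upwards [this] with t ht
    rw [zpow_one, ht]
    congr 1
    ring

/-- Orthogonal generators whose space lies between two consecutive spline spaces generate a
multiresolution analysis. -/
theorem isOrthogonalMRA_of_intertwined [Nonempty ι]
    (hne : ∀ i, (hφ i).toLp (φ i) ≠ 0)
    (horth : Pairwise fun k k' =>
      inner ℝ (translates (fun i => (hφ i).toLp (φ i)) k)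
        (translates (fun i => (hφ i).toLp (φ i)) k') = 0) {N : ℕ}
    (h₁ : splineSpace₀ N ⊆ V₀ (fun i => (hφ i).toLp (φ i)))
    (h₂ : (V₀ (fun i => (hφ i).toLp (φ i)) : Set L2R) ⊆ dilate 1 (splineSpace₀ N)) :
    IsOrthogonalMRA (fun i => (hφ i).toLp (φ i)) ∧
      ∀ p : ℤ, splineSpace N p ⊆ V (fun i => (hφ i).toLp (φ i)) p ∧
        V (fun i => (hφ i).toLp (φ i)) p ⊆ splineSpace N (p + 1) := by
  have hlow : ∀ p, splineSpace N p ⊆ V (fun i => (hφ i).toLp (φ i)) p := fun p => dilate_mono p h₁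
  have hup : ∀ p, V (fun i => (hφ i).toLp (φ i)) p ⊆ splineSpace N (p + 1) := fun p =>
    (dilate_mono p h₂).trans (dilate_dilate_one p _)
  exact ⟨⟨⟨fun p => (hup p).trans (hlow (p + 1)), isRieszBasis_translates hφ hne horth⟩, horth⟩,
    fun p => ⟨hlow p, hup p⟩⟩

end Intertwining

/-! ### Gram matrices of monomials on `[0,1]` -/

section Gram

variable {κ : Type} [Fintype κ] (l : κ → ℕ)

/-- The Gram matrix of the monomials `t ^ l i` on `[0,1]`. -/
def gram : Matrix κ κ ℝ := fun i j => ((l i : ℝ) + l j + 1)⁻¹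

theorem integral_pow_mul_pow (a b : ℕ) :
    ∫ t in (0 : ℝ)..1, t ^ a * t ^ b = ((a : ℝ) + b + 1)⁻¹ := by
  simp_rw [← pow_add]
  rw [integral_pow]
  simp

theorem dotProduct_gram_mulVec (x : κ → ℝ) :
    x ⬝ᵥ (gram l).mulVec x = ∫ t in (0 : ℝ)..1, (∑ i, x i * t ^ l i) ^ 2 := by
  have h : ∀ t : ℝ, (∑ i, x i * t ^ l i) ^ 2 = ∑ i, ∑ j, x i * x j * (t ^ l i * t ^ l j) := by
    intro t
    rw [sq, Finset.sum_mul_sum]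
    exact Finset.sum_congr rfl fun i _ => Finset.sum_congr rfl fun j _ => by ring
  simp_rw [h]
  rw [intervalIntegral.integral_finsetSum
    fun i _ => Continuous.intervalIntegrable (by fun_prop) _ _]
  refine Finset.sum_congr rfl fun i _ => ?_
  rw [intervalIntegral.integral_finsetSum
    fun i _ => Continuous.intervalIntegrable (by fun_prop) _ _, Matrix.mulVec, dotProduct,
    Finset.mul_sum]
  refine Finset.sum_congr rfl fun j _ => ?_
  rw [intervalIntegral.integral_const_mul, integral_pow_mul_pow, gram]
  ring

theorem eq_zero_of_integral_sq_eq_zero {P : ℝ[X]} {a b : ℝ} (hab : a < b)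
    (h : ∫ t in a..b, P.eval t ^ 2 = 0) : P = 0 := by
  have h0 : ∀ t ∈ Set.Icc a b, P.eval t = 0 := by
    by_contra! hne
    obtain ⟨t, ht, hP⟩ := hne
    have := intervalIntegral.integral_pos hab (f := fun t => P.eval t ^ 2)
      (P.continuous.pow 2).continuousOn (fun _ _ => sq_nonneg _) ⟨t, ht, by positivity⟩
    exact this.ne' h
  refine eq_zero_of_infinite_isRoot P ((Set.Icc_infinite hab).mono fun t ht => h0 t ht)

/-- The quadratic form of the Gram matrix is the integral of the square of a polynomial, so a kernel
vector gives the zero polynomial; distinct exponents then make every coefficient vanish. -/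
theorem gram_isUnit [DecidableEq κ] (hl : Function.Injective l) : IsUnit (gram l) := by
  rw [← Matrix.mulVec_injective_iff_isUnit]
  refine (injective_iff_map_eq_zero (gram l).mulVecLin).2 fun x hx => ?_
  have hx' : (gram l).mulVec x = 0 := hx
  have h := dotProduct_gram_mulVec l x
  rw [hx', dotProduct_zero] at h
  have hP : (∑ i, C (x i) * X ^ l i : ℝ[X]) = 0 := by
    refine eq_zero_of_integral_sq_eq_zero (zero_lt_one' ℝ) ?_
    simpa [eval_finsetSum] using h.symm
  funext i
  have := congrArg (fun P => coeff P (l i)) hP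
  simpa [finsetSum_coeff, coeff_C_mul, coeff_X_pow, hl.eq_iff] using this

/-- If the vector `c` of total mass one has constant image `s` under the Gram matrix, then
`s⁻¹ = ∑ (2 l_i + 1)`. -/
theorem gram_constant_mul_sum [DecidableEq κ] (hl : Function.Injective l) {c : κ → ℝ} {s : ℝ}
    (hc : ∑ i, c i = 1) (hG : ∀ j, ∑ i, c i * ((l i : ℝ) + l j + 1)⁻¹ = s) :
    s * ∑ i, (2 * (l i : ℝ) + 1) = 1 := by
  set G := gram l with hGdef
  have hu : IsUnit G.det := (Matrix.isUnit_iff_isUnit_det _).1 (gram_isUnit l hl)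
  set D : Matrix κ κ ℝ := Matrix.diagonal fun i => (l i : ℝ) with hD
  set J : Matrix κ κ ℝ := Matrix.of fun _ _ => 1 with hJ
  -- Entrywise this is `(l_i + l_j + 1) * G_ij = 1`.
  have hsum : D * G + G * D + G = J := by
    ext i j
    have : (l i : ℝ) + l j + 1 ≠ 0 := by positivity
    simp only [hD, hJ, hGdef, Matrix.add_apply, Matrix.diagonal_mul, Matrix.mul_diagonal, gram,
      Matrix.of_apply]
    field_simp
  have hvec : G.mulVec c = fun _ => s := by
    funext j
    rw [← hG j, Matrix.mulVec, dotProduct]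
    refine Finset.sum_congr rfl fun i _ => ?_
    rw [hGdef, gram, mul_comm, add_comm (l j : ℝ)]
  have hinv : s • (G⁻¹).mulVec (fun _ => 1) = c := by
    rw [← Matrix.mulVec_smul]
    have : (s • fun _ => 1 : κ → ℝ) = G.mulVec c := by rw [hvec]; ext; simp
    rw [this, Matrix.mulVec_mulVec, Matrix.nonsing_inv_mul _ hu, Matrix.one_mulVec]
  -- Under the trace, `G⁻¹DG` and `G⁻¹GD` both contribute `tr D`, and `G⁻¹G` contributes the number
  -- of indices.
  have htr : (G⁻¹ * J).trace = ∑ i, (2 * (l i : ℝ) + 1) := by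
    rw [← hsum, mul_add, mul_add, Matrix.trace_add, Matrix.trace_add, ← mul_assoc, ← mul_assoc,
      Matrix.trace_mul_cycle, Matrix.mul_nonsing_inv _ hu, Matrix.nonsing_inv_mul _ hu, one_mul,
      hD, Matrix.trace_diagonal, Matrix.trace_one, Finset.sum_add_distrib, ← Finset.mul_sum]
    simp
    ring
  have htr' : (G⁻¹ * J).trace = ∑ i, (G⁻¹).mulVec (fun _ => 1) i := by
    refine Finset.sum_congr rfl fun i _ => ?_
    simp [Matrix.mul_apply, hJ, Matrix.mulVec, dotProduct]
  rw [← htr, htr', Finset.mul_sum]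
  refine (Finset.sum_congr rfl fun i _ => ?_).trans hc
  exact congrFun hinv i

end Gram

/-! ### The inner product on continuous functions -/

/-- Continuity on `[-1,1]`. -/
abbrev ContOn (f : ℝ → ℝ) : Prop := ContinuousOn f (Set.Icc (-1) 1)

theorem contOn_eval (P : ℝ[X]) : ContOn fun t => P.eval t := P.continuous.continuousOn

theorem ContOn.comp_neg {f : ℝ → ℝ} (hf : ContOn f) : ContOn fun t => f (-t) :=
  ContinuousOn.comp hf continuous_neg.continuousOn fun t ht => by
    constructor <;> linarith [ht.1, ht.2]

theorem ContOn.const_mul {f : ℝ → ℝ} (hf : ContOn f) (c : ℝ) : ContOn fun t => c * f t :=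
  ContinuousOn.mul continuousOn_const hf

theorem ip_comm (f g : ℝ → ℝ) : ip f g = ip g f := by
  simp only [ip, mul_comm]

theorem ip_congr {f f' g g' : ℝ → ℝ} (hf : ∀ t ∈ Set.Icc (-1 : ℝ) 1, f t = f' t)
    (hg : ∀ t ∈ Set.Icc (-1 : ℝ) 1, g t = g' t) : ip f g = ip f' g' := by
  refine intervalIntegral.integral_congr fun t ht => ?_
  rw [Set.uIcc_of_le (by norm_num)] at ht
  simp only [hf t ht, hg t ht]

theorem intervalIntegrable_mul {f g : ℝ → ℝ} (hf : ContOn f) (hg : ContOn g) :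
    IntervalIntegrable (fun t => f t * g t) volume (-1) 1 :=
  ContinuousOn.intervalIntegrable (by
    rw [Set.uIcc_of_le (by norm_num)]; exact ContinuousOn.mul hf hg)

theorem ip_add_left {f g h : ℝ → ℝ} (hf : ContOn f) (hg : ContOn g) (hh : ContOn h) :
    ip (fun t => f t + g t) h = ip f h + ip g h := by
  simp only [ip, add_mul]
  exact intervalIntegral.integral_add (intervalIntegrable_mul hf hh) (intervalIntegrable_mul hg hh)

theorem ip_sub_left {f g h : ℝ → ℝ} (hf : ContOn f) (hg : ContOn g) (hh : ContOn h) :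
    ip (fun t => f t - g t) h = ip f h - ip g h := by
  simp only [ip, sub_mul]
  exact intervalIntegral.integral_sub (intervalIntegrable_mul hf hh) (intervalIntegrable_mul hg hh)

theorem ip_mul_left (c : ℝ) (f g : ℝ → ℝ) : ip (fun t => c * f t) g = c * ip f g := by
  simp only [ip, mul_assoc]
  exact intervalIntegral.integral_const_mul _ _

theorem ip_sum_left {κ : Type} (S : Finset κ) {f : κ → ℝ → ℝ} {h : ℝ → ℝ}
    (hf : ∀ i ∈ S, ContOn (f i)) (hh : ContOn h) :
    ip (fun t => ∑ i ∈ S, f i t) h = ∑ i ∈ S, ip (f i) h := by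
  simp only [ip, Finset.sum_mul]
  exact intervalIntegral.integral_finsetSum fun i hi => intervalIntegrable_mul (hf i hi) hh

theorem ip_add_right {f g h : ℝ → ℝ} (hf : ContOn f) (hg : ContOn g) (hh : ContOn h) :
    ip h (fun t => f t + g t) = ip h f + ip h g := by
  rw [ip_comm, ip_add_left hf hg hh, ip_comm f, ip_comm g]

theorem ip_sub_right {f g h : ℝ → ℝ} (hf : ContOn f) (hg : ContOn g) (hh : ContOn h) :
    ip h (fun t => f t - g t) = ip h f - ip h g := by
  rw [ip_comm, ip_sub_left hf hg hh, ip_comm f, ip_comm g]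

theorem ip_mul_right (c : ℝ) (f g : ℝ → ℝ) : ip f (fun t => c * g t) = c * ip f g := by
  rw [ip_comm, ip_mul_left, ip_comm]

theorem ip_sum_right {κ : Type} (S : Finset κ) {f : κ → ℝ → ℝ} {h : ℝ → ℝ}
    (hf : ∀ i ∈ S, ContOn (f i)) (hh : ContOn h) :
    ip h (fun t => ∑ i ∈ S, f i t) = ∑ i ∈ S, ip h (f i) := by
  rw [ip_comm, ip_sum_left S hf hh]
  exact Finset.sum_congr rfl fun i _ => ip_comm _ _

theorem ip_comp_neg (f g : ℝ → ℝ) : ip (fun t => f (-t)) (fun t => g (-t)) = ip f g := by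
  have := intervalIntegral.integral_comp_neg (a := -1) (b := 1) fun t => f t * g t
  simpa [ip] using this

theorem ip_self_pos {f : ℝ → ℝ} (hf : ContOn f) {t : ℝ} (ht : t ∈ Set.Icc (-1 : ℝ) 1)
    (h : f t ≠ 0) : 0 < ip f f :=
  intervalIntegral.integral_pos (by norm_num) (ContinuousOn.mul hf hf)
    (fun _ _ => mul_self_nonneg _) ⟨t, ht, mul_self_pos.2 h⟩

theorem ip_eval_self_pos {P : ℝ[X]} (hP : P ≠ 0) :
    0 < ip (fun t => P.eval t) fun t => P.eval t := by
  by_contra h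
  refine hP (eq_zero_of_integral_sq_eq_zero (a := -1) (b := 1) (by norm_num) ?_)
  have h0 : 0 ≤ ip (fun t => P.eval t) fun t => P.eval t :=
    intervalIntegral.integral_nonneg (by norm_num) fun t _ => mul_self_nonneg _
  simp only [sq]
  exact le_antisymm (not_lt.1 h) h0

/-! ### The orthogonal polynomials -/

/-- The weight `(1 - t)²(1 + t)²`. -/
def weight (t : ℝ) : ℝ := (1 - t ^ 2) * (1 - t ^ 2)

theorem monicUltraspherical_five_halves (n : ℕ) :
    monicUltraspherical (5 / 2) n = monicOrtho weight n := by
  have : (fun t : ℝ => (1 - t) ^ ((5 / 2 : ℝ) - 1 / 2) * (1 + t) ^ ((5 / 2 : ℝ) - 1 / 2)) =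
      weight := by
    funext t
    have h2 : (5 / 2 : ℝ) - 1 / 2 = (2 : ℕ) := by norm_num
    rw [h2, Real.rpow_natCast, Real.rpow_natCast, weight]
    ring
  rw [monicUltraspherical, monicJacobi, this]

/-- The polynomial `(1 - X²) p_i`. -/
def bubblePoly (i : ℕ) : ℝ[X] := (1 - X ^ 2) * monicOrtho weight i

theorem bubble_eq (j : ℕ) : bubble (j + 2) = fun t => (bubblePoly j).eval t := by
  funext t
  simp [bubble, bubblePoly, monicUltraspherical_five_halves]

theorem degree_sum_C_mul_monicOrtho_lt (w : ℝ → ℝ) {n : ℕ} (c : Fin n → ℝ)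
    (h : ∀ m < n, (monicOrtho w m).degree = m) :
    (∑ i : Fin n, C (c i) * monicOrtho w i).degree < n := by
  refine (degree_sum_le _ _).trans_lt ((Finset.sup_lt_iff (WithBot.bot_lt_coe n)).2 fun i _ => ?_)
  have h1 : (C (c i) * monicOrtho w i).degree ≤ ((i : ℕ) : WithBot ℕ) := by
    refine (degree_mul_le _ _).trans ?_
    rw [h i i.2]
    calc (C (c i)).degree + ((i : ℕ) : WithBot ℕ) ≤ 0 + ((i : ℕ) : WithBot ℕ) := by
          gcongr; exact degree_C_le
      _ = _ := zero_add _
  exact h1.trans_lt (Nat.cast_lt.2 i.2)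

theorem degree_monicOrtho (w : ℝ → ℝ) (n : ℕ) : (monicOrtho w n).degree = n := by
  induction n using Nat.strong_induction_on with
  | _ n ih =>
    rw [monicOrtho, degree_sub_eq_left_of_degree_lt, degree_X_pow]
    rw [degree_X_pow]
    exact degree_sum_C_mul_monicOrtho_lt w _ ih

theorem monic_monicOrtho (w : ℝ → ℝ) (n : ℕ) : (monicOrtho w n).Monic := by
  rw [monicOrtho]
  refine (monic_X_pow n).sub_of_left ?_
  rw [degree_X_pow]
  exact degree_sum_C_mul_monicOrtho_lt w _ fun m _ => degree_monicOrtho w m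

theorem natDegree_monicOrtho (w : ℝ → ℝ) (n : ℕ) : (monicOrtho w n).natDegree = n :=
  natDegree_eq_of_degree_eq_some (degree_monicOrtho w n)

theorem bubblePoly_ne_zero (i : ℕ) : bubblePoly i ≠ 0 := by
  refine mul_ne_zero ?_ (monic_monicOrtho weight i).ne_zero
  intro h
  have := congrArg (eval 0) h
  simp at this

theorem ip_bubblePoly (P Q : ℝ[X]) :
    ip (fun t => ((1 - X ^ 2) * P).eval t) (fun t => ((1 - X ^ 2) * Q).eval t) =
      ∫ t in (-1 : ℝ)..1, P.eval t * Q.eval t * weight t := by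
  refine intervalIntegral.integral_congr fun t _ => ?_
  simp [weight]
  ring

/-- The factor `(1 - X²)²` is the weight, so this is Gram–Schmidt orthogonality, by strong induction
on the larger index. -/
theorem ip_bubblePoly_of_lt {i n : ℕ} (hi : i < n) :
    ip (fun t => (bubblePoly n).eval t) (fun t => (bubblePoly i).eval t) = 0 := by
  induction n using Nat.strong_induction_on generalizing i with
  | _ n ih =>
    set c : Fin n → ℝ := fun i =>
      (∫ t in (-1 : ℝ)..1, t ^ n * (monicOrtho weight i).eval t * weight t) /
      (∫ t in (-1 : ℝ)..1, (monicOrtho weight i).eval t ^ 2 * weight t) with hc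
    have h1 : ∀ t, (bubblePoly n).eval t = ((1 - X ^ 2) * X ^ n : ℝ[X]).eval t -
        ∑ k : Fin n, c k * (bubblePoly k).eval t := by
      intro t
      rw [bubblePoly, monicOrtho, mul_sub, Finset.mul_sum, eval_sub, eval_finsetSum]
      congr 1
      refine Finset.sum_congr rfl fun k _ => ?_
      rw [bubblePoly, mul_left_comm, eval_mul, eval_C]
    simp_rw [h1]
    have hb : ∀ k ∈ (Finset.univ : Finset (Fin n)), ContOn fun t => c k * (bubblePoly k).eval t :=
      fun k _ => (contOn_eval _).const_mul _
    rw [ip_sub_left (contOn_eval _) (continuousOn_finsetSum _ hb) (contOn_eval _),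
      ip_sum_left _ hb (contOn_eval _),
      Finset.sum_eq_single ⟨i, hi⟩, ip_mul_left, bubblePoly, ip_bubblePoly, ip_bubblePoly]
    · have hpos := ip_eval_self_pos (bubblePoly_ne_zero i)
      rw [bubblePoly, ip_bubblePoly] at hpos
      simp only [← sq] at hpos ⊢
      simp only [hc, eval_pow, eval_X]
      rw [div_mul_cancel₀ _ hpos.ne', sub_self]
    · intro k _ hk
      rw [ip_mul_left]
      rcases lt_trichotomy (k : ℕ) i with h | h | h
      · rw [ip_comm, ih i hi h, mul_zero]
      · exact absurd (Fin.ext h) hk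
      · rw [ih k k.2 h, mul_zero]
    · simp

theorem ip_bubblePoly_of_ne {i j : ℕ} (hij : i ≠ j) :
    ip (fun t => (bubblePoly i).eval t) (fun t => (bubblePoly j).eval t) = 0 := by
  rcases lt_or_gt_of_ne hij with h | h
  · rw [ip_comm, ip_bubblePoly_of_lt h]
  · exact ip_bubblePoly_of_lt h

theorem bubble_eq_of_two_le {j : ℕ} (hj : 2 ≤ j) :
    bubble j = fun t => (bubblePoly (j - 2)).eval t := by
  rw [← bubble_eq, Nat.sub_add_cancel hj]

theorem ip_bubble_of_ne {i j : ℕ} (hi : 2 ≤ i) (hj : 2 ≤ j) (hij : i ≠ j) :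
    ip (bubble i) (bubble j) = 0 := by
  rw [bubble_eq_of_two_le hi, bubble_eq_of_two_le hj]
  exact ip_bubblePoly_of_ne (by omega)

theorem ip_bubble_self_pos {j : ℕ} (hj : 2 ≤ j) : 0 < ip (bubble j) (bubble j) := by
  rw [bubble_eq_of_two_le hj]
  exact ip_eval_self_pos (bubblePoly_ne_zero _)

theorem contOn_bubble {j : ℕ} (hj : 2 ≤ j) : ContOn (bubble j) := by
  rw [bubble_eq_of_two_le hj]
  exact contOn_eval _

theorem exists_eq_sum_monicOrtho (w : ℝ → ℝ) (n : ℕ) {P : ℝ[X]} (hP : P.degree < n) :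
    ∃ a : ℕ → ℝ, P = ∑ i ∈ Finset.range n, C (a i) * monicOrtho w i := by
  induction n generalizing P with
  | zero =>
    refine ⟨0, ?_⟩
    rw [Finset.range_zero, Finset.sum_empty, ← degree_eq_bot]
    simpa using hP
  | succ n ih =>
    have hd : (P - C (P.coeff n) * monicOrtho w n).degree < n := by
      rw [degree_lt_iff_coeff_zero]
      intro m hm
      rw [coeff_sub, coeff_C_mul]
      rcases hm.eq_or_lt with rfl | h
      · have := (monic_monicOrtho w n).coeff_natDegree
        rw [natDegree_monicOrtho] at this
        rw [this, mul_one, sub_self]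
      · rw [(degree_lt_iff_coeff_zero P (n + 1)).1 hP m h,
          coeff_eq_zero_of_natDegree_lt (p := monicOrtho w n) (by rwa [natDegree_monicOrtho]),
          mul_zero, sub_self]
    obtain ⟨a, ha⟩ := ih hd
    refine ⟨fun i => if i = n then P.coeff n else a i, ?_⟩
    simp only [Finset.sum_range_succ, if_true]
    rw [← sub_eq_iff_eq_add, ha]
    refine Finset.sum_congr rfl fun i hi => ?_
    rw [if_neg (Finset.mem_range.1 hi).ne]

/-! ### Polynomials vanishing at `±1` -/

/-- The polynomials of degree at most `N` that vanish at `±1`. -/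
def bubbleSpace (N : ℕ) : Submodule ℝ ℝ[X] where
  carrier := {P | P.natDegree ≤ N ∧ P.eval 1 = 0 ∧ P.eval (-1) = 0}
  add_mem' {P Q} hP hQ := ⟨(natDegree_add_le _ _).trans (max_le hP.1 hQ.1),
    by rw [eval_add, hP.2.1, hQ.2.1, add_zero], by rw [eval_add, hP.2.2, hQ.2.2, add_zero]⟩
  zero_mem' := by simp
  smul_mem' c P hP := ⟨(natDegree_smul_le _ _).trans hP.1,
    by rw [eval_smul, hP.2.1, smul_zero], by rw [eval_smul, hP.2.2, smul_zero]⟩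

theorem bubblePoly_mem {N j : ℕ} (hj : j + 2 ≤ N) : bubblePoly j ∈ bubbleSpace N := by
  refine ⟨?_, by simp [bubblePoly], by simp [bubblePoly]⟩
  refine natDegree_mul_le.trans ?_
  rw [natDegree_monicOrtho]
  have : (1 - X ^ 2 : ℝ[X]).natDegree ≤ 2 := by
    refine (natDegree_sub_le _ _).trans ?_
    simp
  omega

theorem comp_neg_mem_bubbleSpace {N : ℕ} {P : ℝ[X]} (hP : P ∈ bubbleSpace N) :
    P.comp (-X) ∈ bubbleSpace N := by
  refine ⟨natDegree_comp_le.trans ?_, by simpa using hP.2.2, by simpa using hP.2.1⟩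
  simpa using hP.1

/-- Vanishing at `±1` means divisibility by `1 - X²`, and the quotient, of degree at most `N - 2`,
expands in the monic orthogonal polynomials. -/
theorem exists_eq_sum_bubble {N : ℕ} (hN : 2 ≤ N) {P : ℝ[X]} (hP : P ∈ bubbleSpace N) :
    ∃ a : ℕ → ℝ, ∀ t, P.eval t = ∑ j ∈ Finset.Icc 2 N, a j * bubble j t := by
  obtain ⟨Q, hQ⟩ : (1 - X ^ 2 : ℝ[X]) ∣ P := by
    have h1 : (X - C 1 : ℝ[X]) ∣ P := dvd_iff_isRoot.2 hP.2.1
    have h2 : (X - C (-1) : ℝ[X]) ∣ P := dvd_iff_isRoot.2 hP.2.2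
    have h3 : IsCoprime (X - C 1 : ℝ[X]) (X - C (-1)) :=
      isCoprime_X_sub_C_of_isUnit_sub (by norm_num)
    have h4 := h3.mul_dvd h1 h2
    have h5 : (1 - X ^ 2 : ℝ[X]) = -((X - C 1) * (X - C (-1))) := by
      simp only [map_neg, map_one]; ring
    rw [h5]
    exact (neg_dvd).2 h4
  have hd : Q.degree < (N - 1 : ℕ) := by
    rw [degree_lt_iff_coeff_zero]
    intro m hm
    by_cases hQ0 : Q = 0
    · simp [hQ0]
    have h2 : (1 - X ^ 2 : ℝ[X]).natDegree = 2 := by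
      rw [show (1 - X ^ 2 : ℝ[X]) = -(X ^ 2 - C 1) by simp, natDegree_neg, natDegree_X_pow_sub_C]
    have h3 : (1 - X ^ 2 : ℝ[X]) ≠ 0 := fun h => by simp [h] at h2
    have h4 := hP.1
    rw [hQ, natDegree_mul h3 hQ0, h2] at h4
    exact coeff_eq_zero_of_natDegree_lt (by omega)
  obtain ⟨a, ha⟩ := exists_eq_sum_monicOrtho weight _ hd
  refine ⟨fun j => a (j - 2), fun t => ?_⟩
  have hI : Finset.Icc 2 N = (Finset.range (N - 1)).map (addRightEmbedding 2) := by
    ext j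
    simp only [Finset.mem_Icc, Finset.mem_map, Finset.mem_range, addRightEmbedding_apply]
    constructor
    · rintro ⟨h1, h2⟩
      exact ⟨j - 2, by omega, by omega⟩
    · rintro ⟨i, hi, rfl⟩
      omega
  rw [hI, Finset.sum_map, hQ, eval_mul, ha, eval_finsetSum, Finset.mul_sum]
  refine Finset.sum_congr rfl fun i _ => ?_
  simp [bubble_eq, bubblePoly]
  ring

/-! ### Residuals -/

/-- The polynomial `P^N f`. -/
def projPoly (N : ℕ) (f : ℝ → ℝ) : ℝ[X] :=
  ∑ j ∈ Finset.Icc 2 N, C (ip f (bubble j) / ip (bubble j) (bubble j)) * bubblePoly (j - 2)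

theorem projPoly_mem (N : ℕ) (f : ℝ → ℝ) : projPoly N f ∈ bubbleSpace N := by
  refine Submodule.sum_mem _ fun j hj => ?_
  rw [← smul_eq_C_mul]
  refine Submodule.smul_mem _ _ (bubblePoly_mem ?_)
  have := Finset.mem_Icc.1 hj
  omega

theorem residual_eq (N : ℕ) (f : ℝ → ℝ) (t : ℝ) :
    residual N f t = f t - (projPoly N f).eval t := by
  rw [residual, projPoly, eval_finsetSum]
  congr 1
  refine Finset.sum_congr rfl fun j hj => ?_
  rw [bubble_eq_of_two_le (Finset.mem_Icc.1 hj).1, eval_mul, eval_C]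

theorem contOn_residual {N : ℕ} {f : ℝ → ℝ} (hf : ContOn f) : ContOn (residual N f) := by
  have : residual N f = fun t => f t - (projPoly N f).eval t := funext (residual_eq N f)
  rw [this]
  exact ContinuousOn.sub hf (contOn_eval _)

theorem ip_residual_bubble {N j : ℕ} {f : ℝ → ℝ} (hf : ContOn f) (hj : j ∈ Finset.Icc 2 N) :
    ip (residual N f) (bubble j) = 0 := by
  have hb : ∀ i ∈ Finset.Icc 2 N, ContOn fun t =>
      ip f (bubble i) / ip (bubble i) (bubble i) * bubble i t := fun i hi =>
    (contOn_bubble (Finset.mem_Icc.1 hi).1).const_mul _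
  have hj2 := (Finset.mem_Icc.1 hj).1
  unfold residual
  rw [ip_sub_left hf (continuousOn_finsetSum _ hb) (contOn_bubble hj2),
    ip_sum_left _ hb (contOn_bubble hj2), Finset.sum_eq_single j, ip_mul_left,
    div_mul_cancel₀ _ (ip_bubble_self_pos hj2).ne', sub_self]
  · intro i hi hij
    rw [ip_mul_left, ip_bubble_of_ne (Finset.mem_Icc.1 hi).1 hj2 hij, mul_zero]
  · exact fun h => absurd hj h

theorem ip_residual_eval {N : ℕ} (hN : 2 ≤ N) {f : ℝ → ℝ} (hf : ContOn f) {P : ℝ[X]}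
    (hP : P ∈ bubbleSpace N) : ip (residual N f) (fun t => P.eval t) = 0 := by
  obtain ⟨a, ha⟩ := exists_eq_sum_bubble hN hP
  simp_rw [ha]
  rw [ip_sum_right _ (fun j hj =>
    (contOn_bubble (Finset.mem_Icc.1 hj).1).const_mul (a j)) (contOn_residual hf)]
  refine Finset.sum_eq_zero fun j hj => ?_
  rw [ip_mul_right, ip_residual_bubble hf hj, mul_zero]

/-- The residual of an odd function is odd. -/
theorem residual_neg_of_odd {N : ℕ} (hN : 2 ≤ N) {f : ℝ → ℝ} (hf : ContOn f)
    (hodd : ∀ t ∈ Set.Icc (-1 : ℝ) 1, f (-t) = -f t) {t : ℝ} (ht : t ∈ Set.Icc (-1 : ℝ) 1) :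
    residual N f (-t) = -residual N f t := by
  set P := projPoly N f with hP
  -- On `[-1,1]`, `D(t) = -(r(t) + r(-t))` with `r` the residual, so `D` lies in the bubble space
  -- and is orthogonal to it.
  set D := P + P.comp (-X) with hD
  have hDm : D ∈ bubbleSpace N :=
    Submodule.add_mem _ (projPoly_mem N f) (comp_neg_mem_bubbleSpace (projPoly_mem N f))
  have hsum : ∀ t ∈ Set.Icc (-1 : ℝ) 1, D.eval t = -(residual N f t + residual N f (-t)) := by
    intro t ht
    rw [residual_eq, residual_eq, hodd t ht, hD, ← hP]
    simp
    ring
  have hR : ContOn (residual N f) := contOn_residual hf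
  have h0 : ip (fun t => D.eval t) (fun t => D.eval t) = 0 := by
    have h1 : ip (fun t => D.eval t) (fun t => D.eval t) =
        ip (fun t => -1 * (residual N f t + residual N f (-t))) (fun t => D.eval t) :=
      ip_congr (fun t ht => by rw [hsum t ht]; ring) fun _ _ => rfl
    have h2 : ip (fun t => residual N f (-t)) (fun t => D.eval t) =
        ip (residual N f) (fun t => (D.comp (-X)).eval t) := by
      rw [← ip_comp_neg]
      simp
    rw [h1, ip_mul_left, ip_add_left hR hR.comp_neg (contOn_eval _), h2,
      ip_residual_eval hN hf hDm, ip_residual_eval hN hf (comp_neg_mem_bubbleSpace hDm)]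
    ring
  have hD0 : D = 0 := by
    by_contra hD0
    exact (ip_eval_self_pos hD0).ne' h0
  have := hsum t ht
  rw [hD0, eval_zero] at this
  linarith

/-! ### The function `w` and the functions `q` -/

/-- The odd function that equals `t ^ (2 n)` for `t ≥ 0`. -/
def oddPow (n : ℕ) (t : ℝ) : ℝ := |t| * t ^ (2 * n - 1)

/-- The function `w = u^0_{4n,2n}`. -/
abbrev wave (n : ℕ) : ℝ → ℝ := u (4 * n) (2 * n)

theorem oddPow_neg {n : ℕ} (hn : 1 ≤ n) (t : ℝ) : oddPow n (-t) = -oddPow n t := by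
  have : Odd (2 * n - 1) := ⟨n - 1, by omega⟩
  rw [oddPow, oddPow, abs_neg, this.neg_pow]
  ring

theorem oddPow_of_nonneg {n : ℕ} (hn : 1 ≤ n) {t : ℝ} (ht : 0 ≤ t) : oddPow n t = t ^ (2 * n) := by
  rw [oddPow, abs_of_nonneg ht, ← pow_succ', Nat.sub_add_cancel (by omega)]

theorem continuous_oddPow (n : ℕ) : Continuous (oddPow n) :=
  continuous_abs.mul (continuous_pow _)

theorem uBar_eq {n : ℕ} {t : ℝ} (ht : t ∈ Set.Icc (-1 : ℝ) 1) :
    uBar (4 * n - 2 * n) t = t - oddPow n t := by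
  have h : 4 * n - 2 * n = 2 * n := by omega
  have h2 : ¬Odd (2 * n) := by simp
  rw [uBar, if_pos ht, h, if_neg h2, oddPow]

theorem contOn_uBar (n : ℕ) : ContOn (uBar (4 * n - 2 * n)) :=
  (continuous_id.sub (continuous_oddPow n)).continuousOn.congr fun _ ht => uBar_eq ht

theorem contOn_wave (n : ℕ) : ContOn (wave n) := contOn_residual (contOn_uBar n)

theorem wave_eq {n : ℕ} {t : ℝ} (ht : t ∈ Set.Icc (-1 : ℝ) 1) :
    wave n t = t - oddPow n t - (projPoly (4 * n) (uBar (4 * n - 2 * n))).eval t := by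
  rw [wave, u, residual_eq, uBar_eq ht]

theorem one_mem_Icc : (1 : ℝ) ∈ Set.Icc (-1 : ℝ) 1 := by norm_num

theorem neg_one_mem_Icc : (-1 : ℝ) ∈ Set.Icc (-1 : ℝ) 1 := by norm_num

theorem neg_mem_Icc {t : ℝ} (ht : t ∈ Set.Icc (-1 : ℝ) 1) : -t ∈ Set.Icc (-1 : ℝ) 1 := by
  constructor <;> linarith [ht.1, ht.2]

theorem wave_neg {n : ℕ} (hn : 1 ≤ n) {t : ℝ} (ht : t ∈ Set.Icc (-1 : ℝ) 1) :
    wave n (-t) = -wave n t := by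
  refine residual_neg_of_odd (by omega) (contOn_uBar n) (fun t ht => ?_) ht
  rw [uBar_eq ht, uBar_eq (neg_mem_Icc ht), oddPow_neg hn]
  ring

theorem wave_one {n : ℕ} (hn : 1 ≤ n) : wave n 1 = 0 := by
  rw [wave_eq one_mem_Icc, oddPow_of_nonneg hn zero_le_one, (projPoly_mem _ _).2.1]
  simp

theorem wave_neg_one {n : ℕ} (hn : 1 ≤ n) : wave n (-1) = 0 := by
  rw [wave_neg hn one_mem_Icc, wave_one hn, neg_zero]

theorem ip_wave_self_pos {n : ℕ} (hn : 1 ≤ n) : 0 < ip (wave n) (wave n) := by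
  suffices h : ∃ t ∈ Set.Icc (-1 : ℝ) 1, wave n t ≠ 0 by
    obtain ⟨t, ht, h⟩ := h
    exact ip_self_pos (contOn_wave n) ht h
  by_contra! h
  set B := projPoly (4 * n) (uBar (4 * n - 2 * n)) with hB
  have hX : (X ^ (2 * n) - (X - B) : ℝ[X]) = 0 := by
    refine eq_zero_of_infinite_isRoot _ ((Set.Icc_infinite (zero_lt_one' ℝ)).mono fun t ht => ?_)
    have ht' : t ∈ Set.Icc (-1 : ℝ) 1 := ⟨by linarith [ht.1], ht.2⟩
    have h1 := wave_eq (n := n) ht'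
    rw [h t ht', oddPow_of_nonneg hn ht.1, ← hB] at h1
    simp only [Set.mem_ofPred_eq, IsRoot.def, eval_sub, eval_pow, eval_X]
    linarith
  -- If `w` vanished, `t^(2n) = t - B(t)` would hold as polynomials; at `-1` it reads `1 = -1`.
  have h1 := congrArg (eval (-1)) hX
  have h2 : B.eval (-1) = 0 := (projPoly_mem _ _).2.2
  simp only [eval_sub, eval_pow, eval_X, h2, eval_zero, (even_two_mul n).neg_one_pow] at h1
  norm_num at h1

theorem contOn_ramp (N : ℕ) : ContOn (rampR N) :=
  contOn_residual (continuous_const.add continuous_id).continuousOn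

theorem rampR_eq (N : ℕ) (t : ℝ) :
    rampR N t = 1 + t - (projPoly N fun t => 1 + t).eval t := residual_eq _ _ _

theorem contOn_qR (n : ℕ) : ContOn (qR (4 * n) (wave n)) :=
  ContinuousOn.sub (contOn_ramp _) ((contOn_wave n).const_mul _)

theorem contOn_qL (n : ℕ) : ContOn (qL (4 * n) (wave n)) := (contOn_qR n).comp_neg

theorem ip_wave_eval {n : ℕ} (hn : 1 ≤ n) {P : ℝ[X]} (hP : P ∈ bubbleSpace (4 * n)) :
    ip (wave n) (fun t => P.eval t) = 0 :=
  ip_residual_eval (by omega) (contOn_uBar n) hP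

theorem ip_qR_wave {n : ℕ} (hn : 1 ≤ n) : ip (qR (4 * n) (wave n)) (wave n) = 0 := by
  have := ip_sub_left (contOn_ramp (4 * n)) ((contOn_wave n).const_mul
    (ip (wave n) (rampR (4 * n)) / ip (wave n) (wave n))) (contOn_wave n)
  refine this.trans ?_
  rw [ip_mul_left, div_mul_cancel₀ _ (ip_wave_self_pos hn).ne', ip_comm, sub_self]

theorem ip_qR_eval {n : ℕ} (hn : 1 ≤ n) {P : ℝ[X]} (hP : P ∈ bubbleSpace (4 * n)) :
    ip (qR (4 * n) (wave n)) (fun t => P.eval t) = 0 := by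
  have := ip_sub_left (contOn_ramp (4 * n)) ((contOn_wave n).const_mul
    (ip (wave n) (rampR (4 * n)) / ip (wave n) (wave n))) (contOn_eval P)
  refine this.trans ?_
  rw [ip_mul_left, ip_wave_eval hn hP, mul_zero, sub_zero]
  exact ip_residual_eval (by omega) (continuous_const.add continuous_id).continuousOn hP

theorem qR_one {n : ℕ} (hn : 1 ≤ n) : qR (4 * n) (wave n) 1 = 2 := by
  rw [qR, wave_one hn, rampR_eq, (projPoly_mem _ _).2.1]
  norm_num

theorem qR_neg_one {n : ℕ} (hn : 1 ≤ n) : qR (4 * n) (wave n) (-1) = 0 := by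
  rw [qR, wave_neg_one hn, rampR_eq, (projPoly_mem _ _).2.2]
  norm_num

/-! ### Orthogonality of `q_r` and `q_l` -/

theorem integral_eq_zero_of_odd {f : ℝ → ℝ} (hf : ∀ t, f (-t) = -f t) :
    ∫ t in (-1 : ℝ)..1, f t = 0 := by
  have h := intervalIntegral.integral_comp_neg (a := -1) (b := 1) f
  simp only [hf, neg_neg, intervalIntegral.integral_neg] at h
  linarith

theorem integral_eq_two_mul_of_even {f : ℝ → ℝ} (hc : Continuous f) (hf : ∀ t, f (-t) = f t) :
    ∫ t in (-1 : ℝ)..1, f t = 2 * ∫ t in (0 : ℝ)..1, f t := by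
  have h := intervalIntegral.integral_comp_neg (a := -1) (b := 0) f
  simp only [hf, neg_neg, neg_zero] at h
  rw [← intervalIntegral.integral_add_adjacent_intervals (hc.intervalIntegrable (-1) 0)
    (hc.intervalIntegrable 0 1), h]
  ring

theorem ip_eq_gram {f g : ℝ → ℝ} {a b : ℕ} (hf : Continuous f) (hg : Continuous g)
    (he : ∀ t, f (-t) * g (-t) = f t * g t) (hfa : ∀ t, 0 ≤ t → f t = t ^ a)
    (hgb : ∀ t, 0 ≤ t → g t = t ^ b) : ip f g = 2 * ((a : ℝ) + b + 1)⁻¹ := by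
  rw [ip, integral_eq_two_mul_of_even (f := fun t => f t * g t) (hf.mul hg) he,
    ← integral_pow_mul_pow]
  congr 1
  refine intervalIntegral.integral_congr fun t ht => ?_
  rw [Set.uIcc_of_le zero_le_one] at ht
  simp only [hfa t ht.1, hgb t ht.1]

/-- The even monomials of degree at most `4 n`. -/
def evenFun (n : ℕ) (i : Fin (2 * n + 1)) (t : ℝ) : ℝ := t ^ (2 * (i : ℕ))

/-- The exponents of `oddFun`. -/
def oddExp (n : ℕ) : Option (Fin (2 * n)) → ℕ
  | none => 2 * n
  | some i => 2 * i + 1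

/-- The odd monomials of degree at most `4 n`, and `oddPow n`. -/
def oddFun (n : ℕ) : Option (Fin (2 * n)) → ℝ → ℝ
  | none => oddPow n
  | some i => fun t => t ^ (2 * (i : ℕ) + 1)

theorem oddExp_injective (n : ℕ) : Function.Injective (oddExp n) := by
  rintro (_ | i) (_ | j) h
  · rfl
  · simp only [oddExp] at h; omega
  · simp only [oddExp] at h; omega
  · simp only [oddExp] at h
    congr 1
    exact Fin.ext (by omega)

theorem evenFun_neg {n : ℕ} (i : Fin (2 * n + 1)) (t : ℝ) : evenFun n i (-t) = evenFun n i t :=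
  (even_two_mul _).neg_pow t

theorem oddFun_neg {n : ℕ} (hn : 1 ≤ n) (i : Option (Fin (2 * n))) (t : ℝ) :
    oddFun n i (-t) = -oddFun n i t := by
  cases i with
  | none => exact oddPow_neg hn t
  | some i => exact (odd_two_mul_add_one _).neg_pow t

theorem continuous_evenFun {n : ℕ} (i : Fin (2 * n + 1)) : Continuous (evenFun n i) :=
  continuous_pow _

theorem continuous_oddFun {n : ℕ} (i : Option (Fin (2 * n))) : Continuous (oddFun n i) := by
  cases i with
  | none => exact continuous_oddPow n
  | some i => exact continuous_pow _

theorem oddFun_of_nonneg {n : ℕ} (hn : 1 ≤ n) (i : Option (Fin (2 * n))) (t : ℝ) (ht : 0 ≤ t) :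
    oddFun n i t = t ^ oddExp n i := by
  cases i with
  | none => exact oddPow_of_nonneg hn ht
  | some i => rfl

theorem ip_evenFun {n : ℕ} (i j : Fin (2 * n + 1)) :
    ip (evenFun n i) (evenFun n j) =
      2 * (((2 * (i : ℕ) : ℕ) : ℝ) + (2 * (j : ℕ) : ℕ) + 1)⁻¹ :=
  ip_eq_gram (continuous_evenFun i) (continuous_evenFun j)
    (fun t => by rw [evenFun_neg, evenFun_neg]) (fun _ _ => rfl) fun _ _ => rfl

theorem ip_oddFun {n : ℕ} (hn : 1 ≤ n) (i j : Option (Fin (2 * n))) :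
    ip (oddFun n i) (oddFun n j) = 2 * ((oddExp n i : ℝ) + oddExp n j + 1)⁻¹ :=
  ip_eq_gram (continuous_oddFun i) (continuous_oddFun j)
    (fun t => by rw [oddFun_neg hn, oddFun_neg hn]; ring) (oddFun_of_nonneg hn i)
    (oddFun_of_nonneg hn j)

theorem ip_oddFun_evenFun {n : ℕ} (hn : 1 ≤ n) (i : Option (Fin (2 * n))) (j : Fin (2 * n + 1)) :
    ip (oddFun n i) (evenFun n j) = 0 :=
  integral_eq_zero_of_odd fun t => by rw [oddFun_neg hn, evenFun_neg]; ring

theorem sum_range_two_mul_add_one (f : ℕ → ℝ) (m : ℕ) :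
    ∑ i ∈ Finset.range (2 * m + 1), f i =
      ∑ i ∈ Finset.range (m + 1), f (2 * i) + ∑ i ∈ Finset.range m, f (2 * i + 1) := by
  induction m with
  | zero => simp
  | succ m ih =>
    rw [show 2 * (m + 1) + 1 = 2 * m + 1 + 1 + 1 by ring, Finset.sum_range_succ,
      Finset.sum_range_succ, ih, Finset.sum_range_succ _ (m + 1), Finset.sum_range_succ _ m,
      Finset.sum_range_succ _ m, show 2 * (m + 1) = 2 * m + 1 + 1 by ring]
    ring

theorem eval_eq_even_add_odd {n : ℕ} {A : ℝ[X]} (hA : A.natDegree ≤ 4 * n) (t : ℝ) :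
    A.eval t = ∑ i : Fin (2 * n + 1), A.coeff (2 * i) * evenFun n i t +
      ∑ i : Fin (2 * n), A.coeff (2 * i + 1) * oddFun n (some i) t := by
  rw [eval_eq_sum_range' (n := 2 * (2 * n) + 1) (by omega), sum_range_two_mul_add_one,
    ← Fin.sum_univ_eq_sum_range (fun i => A.coeff (2 * i) * t ^ (2 * i)),
    ← Fin.sum_univ_eq_sum_range (fun i => A.coeff (2 * i + 1) * t ^ (2 * i + 1))]
  rfl

/-- Both sums equal `(2n+1)(4n+1)`. This is where the exponent `2n` of the extra function is needed.
-/
theorem sum_odd_exponents (n : ℕ) :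
    ∑ i : Option (Fin (2 * n)), (2 * (oddExp n i : ℝ) + 1) =
      ∑ i : Fin (2 * n + 1), (2 * ((2 * (i : ℕ) : ℕ) : ℝ) + 1) := by
  -- Each odd term exceeds its even partner by 2. With `m = 2n` this surplus `4n`, plus `4n + 1`
  -- from the exponent `2n`, matches the last even term `8n + 1`.
  have h : ∀ m : ℕ, ∑ i ∈ Finset.range m, (2 * ((2 * i + 1 : ℕ) : ℝ) + 1) + 2 * m =
      ∑ i ∈ Finset.range m, (2 * ((2 * i : ℕ) : ℝ) + 1) + 4 * m := by
    intro m
    induction m with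
    | zero => simp
    | succ m ih =>
      rw [Finset.sum_range_succ, Finset.sum_range_succ]
      push_cast at ih ⊢
      linarith
  rw [Fintype.sum_option, Fin.sum_univ_eq_sum_range (fun i => 2 * ((2 * i : ℕ) : ℝ) + 1),
    Finset.sum_range_succ]
  simp only [oddExp]
  rw [Fin.sum_univ_eq_sum_range (fun i => 2 * ((2 * i + 1 : ℕ) : ℝ) + 1)]
  have := h (2 * n)
  push_cast at this ⊢
  linarith

/-- The expansion of `q_r` in even and odd functions of value one at `1`. -/
theorem exists_qR_eq {n : ℕ} (hn : 1 ≤ n) :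
    ∃ (c : Fin (2 * n + 1) → ℝ) (d : Option (Fin (2 * n)) → ℝ), ∑ i, c i = 1 ∧ ∑ i, d i = 1 ∧
      ∀ t ∈ Set.Icc (-1 : ℝ) 1, qR (4 * n) (wave n) t =
        ∑ i, c i * evenFun n i t + ∑ i, d i * oddFun n i t := by
  set B₁ := projPoly (4 * n) fun t => 1 + t
  set B₂ := projPoly (4 * n) (uBar (4 * n - 2 * n))
  set a := ip (wave n) (rampR (4 * n)) / ip (wave n) (wave n) with ha
  -- On `[-1,1]`, `q_r = A + a * oddPow n`. From `A(1) = 2 - a` and `A(-1) = a`, the even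
  -- coefficients of `A` sum to 1 and the odd ones to `1 - a`.
  set A : ℝ[X] := 1 + X - B₁ - C a * (X - B₂) with hA
  have hB₁ : B₁ ∈ bubbleSpace (4 * n) := projPoly_mem _ _
  have hB₂ : B₂ ∈ bubbleSpace (4 * n) := projPoly_mem _ _
  have hdeg : A.natDegree ≤ 4 * n := by
    have hX : (X : ℝ[X]).natDegree ≤ 4 * n := natDegree_X_le.trans (by omega)
    have h1 : (1 + X - B₁ : ℝ[X]).natDegree ≤ 4 * n :=
      natDegree_sub_le_of_le (natDegree_add_le_of_degree_le (by simp) hX) hB₁.1 |>.trans (by simp)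
    have h2 : (C a * (X - B₂)).natDegree ≤ 4 * n :=
      (natDegree_C_mul_le _ _).trans ((natDegree_sub_le _ _).trans (max_le hX hB₂.1))
    exact (natDegree_sub_le _ _).trans (max_le h1 h2)
  have hA1 : A.eval 1 = 2 - a := by
    simp only [hA, eval_sub, eval_add, eval_one, eval_X, eval_mul, eval_C, hB₁.2.1, hB₂.2.1]
    ring
  have hA2 : A.eval (-1) = a := by
    simp only [hA, eval_sub, eval_add, eval_one, eval_X, eval_mul, eval_C, hB₁.2.2, hB₂.2.2]
    ring
  have he1 := eval_eq_even_add_odd hdeg 1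
  have he2 := eval_eq_even_add_odd hdeg (-1)
  simp only [evenFun_neg, oddFun_neg hn] at he2
  simp only [evenFun, oddFun, one_pow, mul_one, mul_neg, Finset.sum_neg_distrib] at he1 he2
  rw [hA1] at he1
  rw [hA2] at he2
  refine ⟨fun i => A.coeff (2 * i), fun i => i.elim a fun i => A.coeff (2 * i + 1), ?_, ?_, ?_⟩
  · linarith
  · rw [Fintype.sum_option]
    simp only [Option.elim]
    linarith
  · intro t ht
    rw [Fintype.sum_option]
    simp only [Option.elim]
    have := eval_eq_even_add_odd hdeg t
    rw [qR, wave_eq ht, rampR_eq, ← ha]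
    simp only [hA, eval_sub, eval_add, eval_one, eval_X, eval_mul, eval_C] at this
    have ho : oddFun n none t = oddPow n t := rfl
    rw [ho]
    linear_combination this

/-! ### Inner products of `q_r` with the even and odd basis functions -/

theorem pow_sub_pow_mem_bubbleSpace {N a b : ℕ} (ha : a ≤ N) (hb : b ≤ N)
    (hab : (-1 : ℝ) ^ a = (-1) ^ b) : (X ^ a - X ^ b : ℝ[X]) ∈ bubbleSpace N := by
  refine ⟨(natDegree_sub_le _ _).trans ?_, by simp, by simp [hab]⟩
  simp [ha, hb]

theorem ip_qR_evenFun {n : ℕ} (hn : 1 ≤ n) (i : Fin (2 * n + 1)) :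
    ip (qR (4 * n) (wave n)) (evenFun n i) = ip (qR (4 * n) (wave n)) (evenFun n 0) := by
  have hm : (X ^ (2 * (i : ℕ)) - X ^ 0 : ℝ[X]) ∈ bubbleSpace (4 * n) :=
    pow_sub_pow_mem_bubbleSpace (by omega) (by omega) (by simp)
  rw [← sub_eq_zero, ← ip_sub_right (continuous_evenFun i).continuousOn
    (continuous_evenFun 0).continuousOn (contOn_qR n), ← ip_qR_eval hn hm]
  simp [evenFun]

/-- The difference `t^(2i+1) - oddPow n t` is `w` plus a polynomial vanishing at `±1`, and `q_r` is
orthogonal to both. -/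
theorem ip_qR_oddFun {n : ℕ} (hn : 1 ≤ n) (i : Option (Fin (2 * n))) :
    ip (qR (4 * n) (wave n)) (oddFun n i) = ip (qR (4 * n) (wave n)) (oddFun n none) := by
  cases i with
  | none => rfl
  | some i =>
    set B := projPoly (4 * n) (uBar (4 * n - 2 * n))
    have hm : (X ^ (2 * (i : ℕ) + 1) - X ^ 1 + B : ℝ[X]) ∈ bubbleSpace (4 * n) :=
      Submodule.add_mem _ (pow_sub_pow_mem_bubbleSpace (by omega) (by omega) (by simp [pow_succ]))
        (projPoly_mem _ _)
    rw [← sub_eq_zero, ← ip_sub_right (continuous_oddFun _).continuousOn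
      (continuous_oddFun _).continuousOn (contOn_qR n)]
    have h1 : ip (qR (4 * n) (wave n)) (fun t => oddFun n (some i) t - oddFun n none t) =
        ip (qR (4 * n) (wave n)) (fun t => wave n t +
          (X ^ (2 * (i : ℕ) + 1) - X ^ 1 + B : ℝ[X]).eval t) := by
      refine ip_congr (fun _ _ => rfl) fun t ht => ?_
      rw [wave_eq ht]
      simp [oddFun, B]
    rw [h1, ip_add_right (contOn_wave n) (contOn_eval _) (contOn_qR n), ip_qR_wave hn,
      ip_qR_eval hn hm, add_zero]

theorem ip_qR_qL {n : ℕ} (hn : 1 ≤ n) :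
    ip (qR (4 * n) (wave n)) (qL (4 * n) (wave n)) = 0 := by
  obtain ⟨c, d, hc, hd, hq⟩ := exists_qR_eq hn
  set q := qR (4 * n) (wave n) with hqdef
  have hqc : ContOn q := contOn_qR n
  have hE : ∀ i, ContOn fun t => c i * evenFun n i t := fun i =>
    ContOn.const_mul (continuous_evenFun i).continuousOn _
  have hO : ∀ i, ContOn fun t => d i * oddFun n i t := fun i =>
    ContOn.const_mul (continuous_oddFun i).continuousOn _
  have hEs : ContOn fun t => ∑ i, c i * evenFun n i t := continuousOn_finsetSum _ fun i _ => hE i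
  have hOs : ContOn fun t => ∑ i, d i * oddFun n i t := continuousOn_finsetSum _ fun i _ => hO i
  have hleft : ∀ g, ContOn g → ip q g =
      ∑ i, c i * ip (evenFun n i) g + ∑ i, d i * ip (oddFun n i) g := by
    intro g hg
    rw [ip_congr hq (fun _ _ => rfl), ip_add_left hEs hOs hg, ip_sum_left _ (fun i _ => hE i) hg,
      ip_sum_left _ (fun i _ => hO i) hg]
    simp only [ip_mul_left]
  -- The factor `1/2` passes from the integral of an even product over `[-1,1]` to the Gram matrix
  -- on `[0,1]`; the odd component of `q` drops out by parity.
  have hse : ip q (evenFun n 0) / 2 *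
      ∑ i : Fin (2 * n + 1), (2 * ((2 * (i : ℕ) : ℕ) : ℝ) + 1) = 1 := by
    refine gram_constant_mul_sum (fun i : Fin (2 * n + 1) => 2 * (i : ℕ))
      (fun i j h => Fin.ext (by simpa using h)) hc fun j => ?_
    rw [← ip_qR_evenFun hn j, ← hqdef, hleft _ (continuous_evenFun j).continuousOn]
    simp only [ip_oddFun_evenFun hn, ip_evenFun, mul_zero, Finset.sum_const_zero, add_zero]
    rw [Finset.sum_div]
    exact Finset.sum_congr rfl fun i _ => by ring
  have hso : ip q (oddFun n none) / 2 *
      ∑ i : Option (Fin (2 * n)), (2 * (oddExp n i : ℝ) + 1) = 1 := by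
    refine gram_constant_mul_sum (oddExp n) (oddExp_injective n) hd fun j => ?_
    rw [← ip_qR_oddFun hn j, ← hqdef, hleft _ (continuous_oddFun j).continuousOn]
    simp only [fun i => ip_comm (evenFun n i) (oddFun n j), ip_oddFun_evenFun hn, ip_oddFun hn,
      mul_zero, Finset.sum_const_zero, zero_add]
    rw [Finset.sum_div]
    exact Finset.sum_congr rfl fun i _ => by ring
  rw [sum_odd_exponents] at hso
  have hS : ∑ i : Fin (2 * n + 1), (2 * ((2 * (i : ℕ) : ℕ) : ℝ) + 1) ≠ 0 := fun h => by
    rw [h, mul_zero] at hse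
    exact zero_ne_one hse
  have hs : ip q (evenFun n 0) = ip q (oddFun n none) := by
    have := mul_right_cancel₀ hS (hse.trans hso.symm)
    linarith
  have hL : ∀ t ∈ Set.Icc (-1 : ℝ) 1, qL (4 * n) (wave n) t =
      ∑ i, c i * evenFun n i t - ∑ i, d i * oddFun n i t := by
    intro t ht
    rw [qL, ← hqdef, hq _ (neg_mem_Icc ht)]
    simp only [evenFun_neg, oddFun_neg hn, mul_neg, Finset.sum_neg_distrib]
    ring
  rw [ip_congr (fun _ _ => rfl) hL, ip_sub_right hEs hOs hqc, ip_sum_right _ (fun i _ => hE i) hqc,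
    ip_sum_right _ (fun i _ => hO i) hqc]
  simp only [ip_mul_right]
  have h1 : ∀ i, ip q (evenFun n i) = ip q (evenFun n 0) := ip_qR_evenFun hn
  have h2 : ∀ i, ip q (oddFun n i) = ip q (oddFun n none) := ip_qR_oddFun hn
  simp only [h1, h2]
  rw [← Finset.sum_mul, ← Finset.sum_mul, hc, hd, hs, sub_self]

theorem qL_eq {n : ℕ} (hn : 1 ≤ n) {t : ℝ} (ht : t ∈ Set.Icc (-1 : ℝ) 1) :
    qL (4 * n) (wave n) t = rampL (4 * n) t +
      ip (wave n) (rampR (4 * n)) / ip (wave n) (wave n) * wave n t := by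
  rw [qL, qR, wave_neg hn ht, rampL]
  ring

theorem wGen_zero (n : ℕ) : wGen (4 * n) 0 n 0 = wave n := by
  funext t
  simp [wGen]

/-- As `q_l = l + c w` and `q_r ⊥ w`, the relation `⟨q_r, q_l⟩ = 0` becomes `⟨q_r, l⟩ = 0`.
Expanding `q_r` and multiplying by `⟨w, w⟩ ≠ 0` gives the quadratic equation. -/
theorem isIntertwiningCoeff_zero {n : ℕ} (hn : 1 ≤ n) : IsIntertwiningCoeff (4 * n) 0 n 0 := by
  rw [IsIntertwiningCoeff, wGen_zero]
  have hw := ip_wave_self_pos hn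
  have h := ip_qR_qL hn
  have hl : ContOn (rampL (4 * n)) := (contOn_ramp (4 * n)).comp_neg
  rw [ip_congr (fun _ _ => rfl) fun t ht => qL_eq hn ht,
    ip_add_right hl ((contOn_wave n).const_mul _) (contOn_qR n), ip_mul_right, ip_qR_wave hn,
    mul_zero, add_zero] at h
  have h2 := ip_sub_left (contOn_ramp (4 * n)) ((contOn_wave n).const_mul
    (ip (wave n) (rampR (4 * n)) / ip (wave n) (wave n))) hl
  rw [ip_mul_left] at h2
  have h3 := h2.symm.trans h
  rw [ip_comm (rampR (4 * n)) (wave n)]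
  rw [sub_eq_zero] at h3
  rw [h3]
  field_simp

/-! ### Rationality of the coefficients -/

/-- The rational numbers as a subfield of `ℝ`. -/
abbrev ratField : Subfield ℝ := (algebraMap ℚ ℝ).fieldRange

/-- The real polynomials with rational coefficients. -/
abbrev ratPoly : Subring ℝ[X] := liftsRing (algebraMap ℚ ℝ)

theorem mem_ratPoly_iff {P : ℝ[X]} : P ∈ ratPoly ↔ ∀ n, P.coeff n ∈ ratField := by
  rw [← lifts_iff_liftsRing, lifts_iff_coeff_lifts]
  rfl

theorem C_mem_ratPoly {a : ℝ} (ha : a ∈ ratField) : C a ∈ ratPoly :=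
  (lifts_iff_liftsRing _ _).1 (C'_mem_lifts ha)

theorem X_mem_ratPoly : (X : ℝ[X]) ∈ ratPoly := (lifts_iff_liftsRing _ _).1 (X_mem_lifts _)

theorem integral_mem_ratField {P : ℝ[X]} (hP : P ∈ ratPoly) {a b : ℝ} (ha : a ∈ ratField)
    (hb : b ∈ ratField) : ∫ t in a..b, P.eval t ∈ ratField := by
  simp_rw [eval_eq_sum_range]
  rw [intervalIntegral.integral_finsetSum
    fun i _ => Continuous.intervalIntegrable (by fun_prop) _ _]
  refine sum_mem fun i _ => ?_
  rw [intervalIntegral.integral_const_mul, integral_pow]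
  refine mul_mem (mem_ratPoly_iff.1 hP i) (div_mem (sub_mem (pow_mem hb _) (pow_mem ha _)) ?_)
  exact add_mem (natCast_mem _ _) (one_mem _)

/-- The weight is a rational polynomial, so the Gram–Schmidt coefficients are quotients of rational
integrals. -/
theorem monicOrtho_mem_ratPoly (n : ℕ) : monicOrtho weight n ∈ ratPoly := by
  induction n using Nat.strong_induction_on with
  | _ n ih =>
    have hX := X_mem_ratPoly
    have hw : ((1 - X ^ 2) * (1 - X ^ 2) : ℝ[X]) ∈ ratPoly :=
      mul_mem (sub_mem (one_mem _) (pow_mem hX _)) (sub_mem (one_mem _) (pow_mem hX _))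
    have hmem : ∀ P ∈ ratPoly, ∫ t in (-1 : ℝ)..1, P.eval t * weight t ∈ ratField := by
      intro P hP
      have := integral_mem_ratField (mul_mem hP hw) (neg_mem (one_mem _)) (one_mem _)
      simpa [weight] using this
    rw [monicOrtho]
    refine sub_mem (pow_mem hX _) (sum_mem fun i _ => mul_mem (C_mem_ratPoly (div_mem ?_ ?_))
      (ih i i.2))
    · simpa using hmem _ (mul_mem (pow_mem hX n) (ih i i.2))
    · simpa using hmem _ (pow_mem (ih i i.2) 2)

theorem bubblePoly_mem_ratPoly (n : ℕ) : bubblePoly n ∈ ratPoly :=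
  mul_mem (sub_mem (one_mem _) (pow_mem X_mem_ratPoly _)) (monicOrtho_mem_ratPoly n)

/-- The functions that coincide on each of `[-1,0]` and `[0,1]` with a polynomial of degree at
most `N` with rational coefficients. -/
def RatPieces (N : ℕ) (f : ℝ → ℝ) : Prop :=
  ∃ P ∈ ratPoly, ∃ Q ∈ ratPoly, P.natDegree ≤ N ∧ Q.natDegree ≤ N ∧
    (∀ t ∈ Set.Icc (-1 : ℝ) 0, f t = P.eval t) ∧ ∀ t ∈ Set.Icc (0 : ℝ) 1, f t = Q.eval t

theorem RatPieces.of_poly {N : ℕ} {P : ℝ[X]} (hP : P ∈ ratPoly) (hd : P.natDegree ≤ N) :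
    RatPieces N fun t => P.eval t :=
  ⟨P, hP, P, hP, hd, hd, fun _ _ => rfl, fun _ _ => rfl⟩

theorem RatPieces.sub {N : ℕ} {f g : ℝ → ℝ} (hf : RatPieces N f) (hg : RatPieces N g) :
    RatPieces N fun t => f t - g t := by
  obtain ⟨P, hP, Q, hQ, hPd, hQd, hfP, hfQ⟩ := hf
  obtain ⟨P', hP', Q', hQ', hPd', hQd', hfP', hfQ'⟩ := hg
  exact ⟨P - P', sub_mem hP hP', Q - Q', sub_mem hQ hQ',
    (natDegree_sub_le _ _).trans (max_le hPd hPd'), (natDegree_sub_le _ _).trans (max_le hQd hQd'),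
    fun t ht => by simp only [hfP t ht, hfP' t ht, eval_sub],
    fun t ht => by simp only [hfQ t ht, hfQ' t ht, eval_sub]⟩

theorem RatPieces.const_mul {N : ℕ} {f : ℝ → ℝ} (hf : RatPieces N f) {a : ℝ} (ha : a ∈ ratField) :
    RatPieces N fun t => a * f t := by
  obtain ⟨P, hP, Q, hQ, hPd, hQd, hfP, hfQ⟩ := hf
  exact ⟨C a * P, mul_mem (C_mem_ratPoly ha) hP, C a * Q, mul_mem (C_mem_ratPoly ha) hQ,
    (natDegree_C_mul_le _ _).trans hPd, (natDegree_C_mul_le _ _).trans hQd,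
    fun t ht => by simp only [hfP t ht, eval_mul, eval_C],
    fun t ht => by simp only [hfQ t ht, eval_mul, eval_C]⟩

theorem comp_mem_ratPoly {P : ℝ[X]} (hP : P ∈ ratPoly) {Q : ℝ[X]} (hQ : Q ∈ ratPoly) :
    P.comp Q ∈ ratPoly := by
  rw [comp_eq_sum_left, sum_def]
  exact sum_mem fun i _ => mul_mem (C_mem_ratPoly (mem_ratPoly_iff.1 hP i)) (pow_mem hQ i)

theorem RatPieces.comp_neg {N : ℕ} {f : ℝ → ℝ} (hf : RatPieces N f) :
    RatPieces N fun t => f (-t) := by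
  obtain ⟨P, hP, Q, hQ, hPd, hQd, hfP, hfQ⟩ := hf
  have hX : (-X : ℝ[X]) ∈ ratPoly := neg_mem X_mem_ratPoly
  refine ⟨Q.comp (-X), comp_mem_ratPoly hQ hX, P.comp (-X), comp_mem_ratPoly hP hX,
    natDegree_comp_le.trans (by simpa using hQd), natDegree_comp_le.trans (by simpa using hPd),
    fun t ht => ?_, fun t ht => ?_⟩
  · simp [hfQ (-t) ⟨by linarith [ht.2], by linarith [ht.1]⟩]
  · simp [hfP (-t) ⟨by linarith [ht.2], by linarith [ht.1]⟩]

theorem RatPieces.ip_mem {N M : ℕ} {f g : ℝ → ℝ} (hf : RatPieces N f) (hg : RatPieces M g) :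
    ip f g ∈ ratField := by
  obtain ⟨P, hP, Q, hQ, -, -, hfP, hfQ⟩ := hf
  obtain ⟨P', hP', Q', hQ', -, -, hfP', hfQ'⟩ := hg
  have h1 : Set.EqOn (fun t => f t * g t) (fun t => (P * P').eval t) (Set.uIcc (-1) 0) := by
    intro t ht
    rw [Set.uIcc_of_le (by norm_num)] at ht
    simp only [hfP t ht, hfP' t ht, eval_mul]
  have h2 : Set.EqOn (fun t => f t * g t) (fun t => (Q * Q').eval t) (Set.uIcc 0 1) := by
    intro t ht
    rw [Set.uIcc_of_le (by norm_num)] at ht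
    simp only [hfQ t ht, hfQ' t ht, eval_mul]
  have i1 : IntervalIntegrable (fun t => f t * g t) volume (-1) 0 :=
    ((P * P').continuous.continuousOn.congr h1).intervalIntegrable
  have i2 : IntervalIntegrable (fun t => f t * g t) volume 0 1 :=
    ((Q * Q').continuous.continuousOn.congr h2).intervalIntegrable
  rw [ip, ← intervalIntegral.integral_add_adjacent_intervals i1 i2,
    intervalIntegral.integral_congr h1, intervalIntegral.integral_congr h2]
  exact add_mem (integral_mem_ratField (mul_mem hP hP') (neg_mem (one_mem _)) (zero_mem _))
    (integral_mem_ratField (mul_mem hQ hQ') (zero_mem _) (one_mem _))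

theorem ratPieces_bubble {N j : ℕ} (hj : 2 ≤ j) (hjN : j ≤ N) : RatPieces N (bubble j) := by
  rw [bubble_eq_of_two_le hj]
  exact RatPieces.of_poly (bubblePoly_mem_ratPoly _)
    (bubblePoly_mem (N := N) (by omega)).1

theorem RatPieces.residual {N : ℕ} {f : ℝ → ℝ} (hf : RatPieces N f) :
    RatPieces N (residual N f) := by
  have hP : projPoly N f ∈ ratPoly := by
    refine sum_mem fun j hj => mul_mem (C_mem_ratPoly ?_) (bubblePoly_mem_ratPoly _)
    have hj' := Finset.mem_Icc.1 hj
    have hb := ratPieces_bubble hj'.1 hj'.2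
    exact div_mem (hf.ip_mem hb) (hb.ip_mem hb)
  have : SplineMRA.residual N f = fun t => f t - (projPoly N f).eval t := funext (residual_eq N f)
  rw [this]
  exact hf.sub (RatPieces.of_poly hP (projPoly_mem N f).1)

theorem ratPieces_uBar {n : ℕ} (hn : 1 ≤ n) : RatPieces (4 * n) (uBar (4 * n - 2 * n)) := by
  have hX := X_mem_ratPoly
  have hXd : (X : ℝ[X]).natDegree ≤ 4 * n := natDegree_X_le.trans (by omega)
  have hpd : (X ^ (2 * n) : ℝ[X]).natDegree ≤ 4 * n := (natDegree_X_pow_le _).trans (by omega)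
  refine ⟨X + X ^ (2 * n), add_mem hX (pow_mem hX _), X - X ^ (2 * n), sub_mem hX (pow_mem hX _),
    (natDegree_add_le _ _).trans (max_le hXd hpd), (natDegree_sub_le _ _).trans (max_le hXd hpd),
    fun t ht => ?_, fun t ht => ?_⟩
  · rw [uBar_eq ⟨ht.1, by linarith [ht.2]⟩, ← neg_neg t, oddPow_neg hn,
      oddPow_of_nonneg hn (by linarith [ht.2])]
    simp [(even_two_mul n).neg_pow]
  · rw [uBar_eq ⟨by linarith [ht.1], ht.2⟩, oddPow_of_nonneg hn ht.1]
    simp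

theorem ratPieces_wave {n : ℕ} (hn : 1 ≤ n) : RatPieces (4 * n) (wave n) :=
  (ratPieces_uBar hn).residual

theorem ratPieces_rampR {N : ℕ} (hN : 1 ≤ N) : RatPieces N (rampR N) := by
  refine RatPieces.residual ?_
  have h : RatPieces N fun t => (1 + X : ℝ[X]).eval t :=
    RatPieces.of_poly (add_mem (one_mem _) X_mem_ratPoly)
      ((natDegree_add_le _ _).trans (max_le (by simp) (natDegree_X_le.trans hN)))
  simpa using h

theorem ratPieces_qR {n : ℕ} (hn : 1 ≤ n) : RatPieces (4 * n) (qR (4 * n) (wave n)) := by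
  have hw := ratPieces_wave hn
  have hr := ratPieces_rampR (N := 4 * n) (by omega)
  exact hr.sub (hw.const_mul (div_mem (hw.ip_mem hr) (hw.ip_mem hw)))

theorem ratPieces_qL {n : ℕ} (hn : 1 ≤ n) : RatPieces (4 * n) (qL (4 * n) (wave n)) :=
  (ratPieces_qR hn).comp_neg

/-! ### The generators on `[-1,0]` and `[0,1]` -/

/-- The function on `[-1,1]` that gives the generator of index `j` on `[0,1]`. -/
def rightPiece (n j : ℕ) : ℝ → ℝ :=
  if j = 0 then qL (4 * n) (wave n) else if j = 1 then wave n else bubble j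

/-- The function on `[-1,1]` that gives the generator of index `j` on `[-1,0]`. -/
def leftPiece (n j : ℕ) : ℝ → ℝ :=
  if j = 0 then qR (4 * n) (wave n) else fun _ => 0

theorem rightPiece_zero (n : ℕ) : rightPiece n 0 = qL (4 * n) (wave n) := rfl

theorem rightPiece_one (n : ℕ) : rightPiece n 1 = wave n := rfl

theorem rightPiece_of_two_le {n j : ℕ} (hj : 2 ≤ j) : rightPiece n j = bubble j := by
  rw [rightPiece, if_neg (by omega), if_neg (by omega)]

theorem leftPiece_zero (n : ℕ) : leftPiece n 0 = qR (4 * n) (wave n) := rfl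

theorem leftPiece_of_ne {n j : ℕ} (hj : j ≠ 0) : leftPiece n j = fun _ => 0 := if_neg hj

/-- The three kinds of generators. -/
theorem index_cases (j : ℕ) : j = 0 ∨ j = 1 ∨ 2 ≤ j := by omega

theorem bubble_one {j : ℕ} : bubble j 1 = 0 := by simp [bubble]

theorem bubble_neg_one {j : ℕ} : bubble j (-1) = 0 := by simp [bubble]

theorem rightPiece_apply_one {n : ℕ} (hn : 1 ≤ n) (j : ℕ) : rightPiece n j 1 = 0 := by
  rcases index_cases j with rfl | rfl | hj
  · rw [rightPiece_zero, qL, qR_neg_one hn]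
  · exact wave_one hn
  · rw [rightPiece_of_two_le hj, bubble_one]

theorem rightPiece_apply_neg_one {n : ℕ} (hn : 1 ≤ n) (j : ℕ) :
    rightPiece n j (-1) = leftPiece n j 1 := by
  rcases index_cases j with rfl | rfl | hj
  · rw [rightPiece_zero, qL, neg_neg, leftPiece_zero]
  · rw [rightPiece_one, wave_neg_one hn, leftPiece_of_ne one_ne_zero]
  · rw [rightPiece_of_two_le hj, bubble_neg_one, leftPiece_of_ne (by omega)]

theorem leftPiece_apply_neg_one {n : ℕ} (hn : 1 ≤ n) (j : ℕ) : leftPiece n j (-1) = 0 := by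
  rcases eq_or_ne j 0 with rfl | hj
  · rw [leftPiece_zero, qR_neg_one hn]
  · rw [leftPiece_of_ne hj]

/-! ### Gluing the pieces at the integers -/

theorem Phi_eq_ite (n : ℕ) (i : Fin (4 * n + 1)) (t : ℝ) :
    Phi n i t = if -1 ≤ t ∧ t < 0 then leftPiece n i (2 * t + 1)
      else if 0 ≤ t ∧ t < 1 then rightPiece n i (2 * t - 1) else 0 := by
  unfold Phi scalingVector leftPiece rightPiece
  by_cases h0 : i.val = 0
  · simp only [h0, if_true]
  · simp only [h0, if_false]
    by_cases h1 : -1 ≤ t ∧ t < 0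
    · have h2 : ¬(0 ≤ t ∧ t < 1) := fun h => by linarith [h.1, h1.2]
      simp [h1, h2]
    · simp only [h1, if_false]
      split_ifs <;> rfl

theorem Phi_of_mem_Icc_zero_one {n : ℕ} (hn : 1 ≤ n) (i : Fin (4 * n + 1)) {t : ℝ}
    (ht : t ∈ Set.Icc (0 : ℝ) 1) : Phi n i t = rightPiece n i (2 * t - 1) := by
  rw [Phi_eq_ite, if_neg (fun h => by linarith [ht.1, h.2])]
  rcases ht.2.eq_or_lt with rfl | h
  · rw [if_neg (by norm_num), show (2 * 1 - 1 : ℝ) = 1 by norm_num, rightPiece_apply_one hn]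
  · rw [if_pos ⟨ht.1, h⟩]

theorem Phi_of_mem_Icc_neg_one_zero {n : ℕ} (hn : 1 ≤ n) (i : Fin (4 * n + 1)) {t : ℝ}
    (ht : t ∈ Set.Icc (-1 : ℝ) 0) : Phi n i t = leftPiece n i (2 * t + 1) := by
  rcases ht.2.eq_or_lt with rfl | h
  · rw [Phi_of_mem_Icc_zero_one hn i (by norm_num), show (2 * 0 - 1 : ℝ) = -1 by norm_num,
      rightPiece_apply_neg_one hn, show (2 * 0 + 1 : ℝ) = 1 by norm_num]
  · rw [Phi_eq_ite, if_pos ⟨ht.1, h⟩]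

theorem Phi_of_one_le_abs {n : ℕ} (hn : 1 ≤ n) (i : Fin (4 * n + 1)) (t : ℝ) (ht : 1 ≤ |t|) :
    Phi n i t = 0 := by
  rcases le_abs'.1 ht with h | h
  · rcases h.eq_or_lt with rfl | h
    · rw [Phi_of_mem_Icc_neg_one_zero hn i (by norm_num), show (2 * -1 + 1 : ℝ) = -1 by norm_num,
        leftPiece_apply_neg_one hn]
    · rw [Phi_eq_ite, if_neg (fun h' => by linarith [h'.1]), if_neg (fun h' => by linarith [h'.1])]
  · rw [Phi_eq_ite, if_neg (fun h' => by linarith [h'.2]), if_neg (fun h' => by linarith [h'.2])]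

theorem Phi_zero_neg {n : ℕ} (hn : 1 ≤ n) (t : ℝ) : Phi n 0 (-t) = Phi n 0 t := by
  wlog ht : 0 ≤ t generalizing t
  · have := this (-t) (by linarith)
    rw [neg_neg] at this
    exact this.symm
  by_cases h1 : t ≤ 1
  · rw [Phi_of_mem_Icc_zero_one hn 0 ⟨ht, h1⟩,
      Phi_of_mem_Icc_neg_one_zero hn 0 ⟨by linarith, by linarith⟩]
    simp only [Fin.val_zero, leftPiece_zero, rightPiece_zero, qL]
    congr 1
    ring
  · rw [not_le] at h1
    rw [Phi_of_one_le_abs hn, Phi_of_one_le_abs hn]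
    · rw [abs_of_nonneg ht]; exact h1.le
    · rw [abs_neg, abs_of_nonneg ht]; exact h1.le

/-! ### Piecewise polynomials -/

theorem ratPieces_rightPiece {n j : ℕ} (hn : 1 ≤ n) (hj : j ≤ 4 * n) :
    RatPieces (4 * n) (rightPiece n j) := by
  rcases index_cases j with rfl | rfl | hj'
  · exact ratPieces_qL hn
  · exact ratPieces_wave hn
  · rw [rightPiece_of_two_le hj']
    exact ratPieces_bubble hj' hj

theorem ratPieces_leftPiece {n : ℕ} (hn : 1 ≤ n) (j : ℕ) :
    RatPieces (4 * n) (leftPiece n j) := by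
  rcases eq_or_ne j 0 with rfl | hj
  · exact ratPieces_qR hn
  · rw [leftPiece_of_ne hj]
    simpa using RatPieces.of_poly (N := 4 * n) (zero_mem ratPoly) (by simp)

/-- A function given on the halves of an interval of length one by rational polynomials is given
by rational polynomials on the corresponding half-integer intervals. -/
theorem RatPieces.exists_comp {N : ℕ} {f g : ℝ → ℝ} (hf : RatPieces N f) {a : ℤ} {k : ℤ}
    (hk : k = a - 1 ∨ k = a)
    (hg : ∀ t ∈ Set.Icc (((a : ℝ) - 1) / 2) (((a : ℝ) + 1) / 2), g t = f (2 * t - a)) :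
    ∃ P ∈ ratPoly, P.natDegree ≤ N ∧
      ∀ t ∈ Set.Icc ((k : ℝ) / 2) (((k : ℝ) + 1) / 2), g t = P.eval t := by
  obtain ⟨P, hP, Q, hQ, hPd, hQd, hfP, hfQ⟩ := hf
  set L : ℝ[X] := C 2 * X - C (a : ℝ) with hL
  have hLm : L ∈ ratPoly := sub_mem (mul_mem (C_mem_ratPoly (ofNat_mem _ 2)) X_mem_ratPoly)
    (C_mem_ratPoly (intCast_mem _ _))
  have hLd : L.natDegree ≤ 1 := by
    refine (natDegree_sub_le _ _).trans (max_le ?_ (by simp))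
    exact (natDegree_C_mul_le _ _).trans natDegree_X_le
  have hd : ∀ R : ℝ[X], R.natDegree ≤ N → (R.comp L).natDegree ≤ N := fun R hR =>
    natDegree_comp_le.trans ((Nat.mul_le_mul hR hLd).trans (mul_one N).le)
  rcases hk with rfl | rfl
  · refine ⟨P.comp L, comp_mem_ratPoly hP hLm, hd P hPd, fun t ht => ?_⟩
    push_cast at ht
    rw [hg t ⟨ht.1, by linarith [ht.2]⟩, hfP _ ⟨by linarith [ht.1], by linarith [ht.2]⟩]
    simp [hL]
  · refine ⟨Q.comp L, comp_mem_ratPoly hQ hLm, hd Q hQd, fun t ht => ?_⟩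
    rw [hg t ⟨by linarith [ht.1], ht.2⟩, hfQ _ ⟨by linarith [ht.1], by linarith [ht.2]⟩]
    simp [hL]

theorem exists_ratPoly_eq_Phi {n : ℕ} (hn : 1 ≤ n) (i : Fin (4 * n + 1)) (k : ℤ) :
    ∃ P ∈ ratPoly, P.natDegree ≤ 4 * n ∧
      ∀ t ∈ Set.Icc ((k : ℝ) / 2) (((k : ℝ) + 1) / 2), Phi n i t = P.eval t := by
  have hcases : (k ≤ -3 ∨ 2 ≤ k) ∨ (k = -1 - 1 ∨ k = -1) ∨ (k = 1 - 1 ∨ k = 1) := by omega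
  rcases hcases with h | h | h
  · refine ⟨0, zero_mem _, by simp, fun t ht => ?_⟩
    rw [Phi_of_one_le_abs hn, eval_zero]
    rw [le_abs]
    rcases h with h | h
    · have : (k : ℝ) ≤ -3 := by exact_mod_cast h
      right; linarith [ht.2]
    · have : (2 : ℝ) ≤ k := by exact_mod_cast h
      left; linarith [ht.1]
  · refine (ratPieces_leftPiece hn i).exists_comp h fun t ht => ?_
    push_cast at ht ⊢
    rw [Phi_of_mem_Icc_neg_one_zero hn i ⟨by linarith [ht.1], by linarith [ht.2]⟩, sub_neg_eq_add]
  · refine (ratPieces_rightPiece hn (Nat.lt_succ_iff.1 i.2)).exists_comp h fun t ht => ?_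
    push_cast at ht ⊢
    rw [Phi_of_mem_Icc_zero_one hn i ⟨by linarith [ht.1], by linarith [ht.2]⟩]

theorem exists_rat_polynomial_eq_Phi {n : ℕ} (hn : 1 ≤ n) (i : Fin (4 * n + 1)) (k : ℤ) :
    ∃ P : ℚ[X], P.natDegree ≤ 4 * n ∧
      ∀ t ∈ Set.Icc ((k : ℝ) / 2) (((k : ℝ) + 1) / 2), Phi n i t = aeval t P := by
  obtain ⟨P, hP, hd, h⟩ := exists_ratPoly_eq_Phi hn i k
  obtain ⟨Q, hQ, hQd⟩ := exists_natDegree_eq_of_mem_lifts ((lifts_iff_liftsRing _ _).2 hP)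
  refine ⟨Q, hQd.trans_le hd, fun t ht => ?_⟩
  rw [h t ht, ← hQ, eval_map_algebraMap]

/-! ### Continuity, compact support and square integrability of the generators -/

theorem continuous_of_eqOn_half_intervals {f : ℝ → ℝ}
    (h : ∀ k : ℤ, ∃ P : ℝ[X], ∀ t ∈ Set.Icc ((k : ℝ) / 2) (((k : ℝ) + 1) / 2), f t = P.eval t) :
    Continuous f := by
  have hlf : LocallyFinite fun k : ℤ => Set.Icc ((k : ℝ) / 2) (((k : ℝ) + 1) / 2) := by
    intro x
    refine ⟨Set.Ioo (x - 1) (x + 1), Ioo_mem_nhds (by linarith) (by linarith),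
      (Set.finite_Icc (⌊2 * x⌋ - 3) (⌊2 * x⌋ + 3)).subset ?_⟩
    rintro k ⟨t, ht, ht'⟩
    have h1 := Int.floor_le (2 * x)
    have h2 := Int.lt_floor_add_one (2 * x)
    constructor
    · have : ((⌊2 * x⌋ - 3 : ℤ) : ℝ) < k + 1 := by push_cast; linarith [ht.2, ht'.1]
      have : (⌊2 * x⌋ - 3 : ℤ) < k + 1 := by exact_mod_cast this
      omega
    · have : (k : ℝ) < ((⌊2 * x⌋ + 3 : ℤ) : ℝ) := by push_cast; linarith [ht.1, ht'.2]
      exact le_of_lt (by exact_mod_cast this)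
  refine hlf.continuous ?_ (fun k => isClosed_Icc) fun k => ?_
  · refine Set.eq_univ_of_forall fun x => Set.mem_iUnion.2 ⟨⌊2 * x⌋, ?_⟩
    have h1 := Int.floor_le (2 * x)
    have h2 := Int.lt_floor_add_one (2 * x)
    constructor <;> linarith
  · obtain ⟨P, hP⟩ := h k
    exact P.continuous.continuousOn.congr hP

theorem continuous_Phi {n : ℕ} (hn : 1 ≤ n) (i : Fin (4 * n + 1)) : Continuous (Phi n i) :=
  continuous_of_eqOn_half_intervals fun k =>
    let ⟨P, _, _, h⟩ := exists_ratPoly_eq_Phi hn i k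
    ⟨P, h⟩

theorem hasCompactSupport_Phi {n : ℕ} (hn : 1 ≤ n) (i : Fin (4 * n + 1)) :
    HasCompactSupport (Phi n i) := by
  refine HasCompactSupport.intro (isCompact_Icc (a := (-1 : ℝ)) (b := 1)) fun t ht => ?_
  refine Phi_of_one_le_abs hn i t ?_
  by_contra h
  exact ht (abs_le.1 (not_le.1 h).le)

theorem memLp_Phi {n : ℕ} (hn : 1 ≤ n) (i : Fin (4 * n + 1)) : MemLp (Phi n i) 2 volume :=
  (continuous_Phi hn i).memLp_of_hasCompactSupport (hasCompactSupport_Phi hn i)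

/-! ### Inner products of the generators -/

theorem contOn_rightPiece (n j : ℕ) : ContOn (rightPiece n j) := by
  rcases index_cases j with rfl | rfl | hj
  · exact contOn_qL n
  · exact contOn_wave n
  · rw [rightPiece_of_two_le hj]
    exact contOn_bubble hj

theorem ip_zero_right (f : ℝ → ℝ) : ip f (fun _ => 0) = 0 := by simp [ip]

theorem ip_qL_wave {n : ℕ} (hn : 1 ≤ n) : ip (qL (4 * n) (wave n)) (wave n) = 0 := by
  rw [← ip_comp_neg]
  simp only [qL, neg_neg]
  rw [ip_congr (g' := fun t => -1 * wave n t) (fun _ _ => rfl)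
    fun t ht => by rw [wave_neg hn ht]; ring]
  rw [ip_mul_right]
  exact mul_eq_zero_of_right _ (ip_qR_wave hn)

theorem ip_qL_eval {n : ℕ} (hn : 1 ≤ n) {P : ℝ[X]} (hP : P ∈ bubbleSpace (4 * n)) :
    ip (qL (4 * n) (wave n)) (fun t => P.eval t) = 0 := by
  rw [← ip_comp_neg]
  simp only [qL, neg_neg]
  simpa using ip_qR_eval hn (comp_neg_mem_bubbleSpace hP)

theorem bubble_eq_eval {N j : ℕ} (hj : 2 ≤ j) (hjN : j ≤ N) :
    ∃ P ∈ bubbleSpace N, bubble j = fun t => P.eval t :=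
  ⟨_, bubblePoly_mem (by omega), bubble_eq_of_two_le hj⟩

theorem ip_rightPiece_of_lt {n i j : ℕ} (hn : 1 ≤ n) (hij : i < j) (hj : j ≤ 4 * n) :
    ip (rightPiece n i) (rightPiece n j) = 0 := by
  rcases index_cases j with rfl | rfl | hj'
  · omega
  · obtain rfl : i = 0 := by omega
    exact ip_qL_wave hn
  · rw [rightPiece_of_two_le hj']
    obtain ⟨P, hP, hb⟩ := bubble_eq_eval hj' hj
    rcases index_cases i with rfl | rfl | hi
    · rw [hb]
      exact ip_qL_eval hn hP
    · rw [hb]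
      exact ip_wave_eval hn hP
    · rw [rightPiece_of_two_le hi]
      exact ip_bubble_of_ne hi hj' hij.ne

theorem ip_rightPiece_add_leftPiece {n i j : ℕ} (hn : 1 ≤ n) (hij : i ≠ j) (hi : i ≤ 4 * n)
    (hj : j ≤ 4 * n) :
    ip (rightPiece n i) (rightPiece n j) + ip (leftPiece n i) (leftPiece n j) = 0 := by
  have hr : ip (rightPiece n i) (rightPiece n j) = 0 := by
    rcases lt_or_gt_of_ne hij with h | h
    · exact ip_rightPiece_of_lt hn h hj
    · rw [ip_comm]
      exact ip_rightPiece_of_lt hn h hi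
  have hl : ip (leftPiece n i) (leftPiece n j) = 0 := by
    by_cases h : j = 0
    · rw [ip_comm, leftPiece_of_ne (j := i) (by omega), ip_zero_right]
    · rw [leftPiece_of_ne h, ip_zero_right]
  rw [hr, hl, add_zero]

theorem ip_leftPiece_rightPiece {n i j : ℕ} (hn : 1 ≤ n) (hj : j ≤ 4 * n) :
    ip (leftPiece n i) (rightPiece n j) = 0 := by
  rcases eq_or_ne i 0 with rfl | hi
  · rw [leftPiece_zero]
    rcases index_cases j with rfl | rfl | hj'
    · exact ip_qR_qL hn
    · exact ip_qR_wave hn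
    · obtain ⟨P, hP, hb⟩ := bubble_eq_eval hj' hj
      rw [rightPiece_of_two_le hj', hb]
      exact ip_qR_eval hn hP
  · rw [leftPiece_of_ne hi, ip_comm, ip_zero_right]

theorem ip_rightPiece_self_pos {n : ℕ} (hn : 1 ≤ n) (j : ℕ) :
    0 < ip (rightPiece n j) (rightPiece n j) := by
  rcases index_cases j with rfl | rfl | hj
  · refine ip_self_pos (contOn_rightPiece n 0) neg_one_mem_Icc ?_
    rw [rightPiece_zero, qL, neg_neg, qR_one hn]
    norm_num
  · exact ip_wave_self_pos hn
  · rw [rightPiece_of_two_le hj]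
    exact ip_bubble_self_pos hj

theorem ip_self_nonneg (f : ℝ → ℝ) : 0 ≤ ip f f :=
  intervalIntegral.integral_nonneg (by norm_num) fun _ _ => mul_self_nonneg _

theorem integral_comp_two_mul_sub_one (f g : ℝ → ℝ) :
    ∫ t in (0 : ℝ)..1, f (2 * t - 1) * g (2 * t - 1) = ip f g / 2 := by
  have := intervalIntegral.integral_comp_mul_sub (a := 0) (b := 1) (fun t => f t * g t)
    (c := (2 : ℝ)) two_ne_zero 1
  simp only [this]
  norm_num [ip]
  ring

theorem integral_comp_two_mul_add_one (f g : ℝ → ℝ) :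
    ∫ t in (-1 : ℝ)..0, f (2 * t + 1) * g (2 * t + 1) = ip f g / 2 := by
  have := intervalIntegral.integral_comp_mul_add (a := -1) (b := 0) (fun t => f t * g t)
    (c := (2 : ℝ)) two_ne_zero 1
  simp only [this]
  norm_num [ip]
  ring

theorem inner_translates_Phi {n : ℕ} (hn : 1 ≤ n) (k k' : Fin (4 * n + 1) × ℤ) :
    inner ℝ (translates (fun i => (memLp_Phi hn i).toLp (Phi n i)) k)
      (translates (fun i => (memLp_Phi hn i).toLp (Phi n i)) k') =
    (∫ t in (-1 : ℝ)..0, Phi n k.1 t * Phi n k'.1 (t - (k'.2 - k.2 : ℤ))) +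
      ∫ t in (0 : ℝ)..1, Phi n k.1 t * Phi n k'.1 (t - (k'.2 - k.2 : ℤ)) := by
  have hc : Continuous fun t : ℝ => Phi n k.1 t * Phi n k'.1 (t - (k'.2 - k.2 : ℤ)) :=
    (continuous_Phi hn _).mul ((continuous_Phi hn _).comp (continuous_id.sub continuous_const))
  rw [intervalIntegral.integral_add_adjacent_intervals (hc.intervalIntegrable _ _)
    (hc.intervalIntegrable _ _), L2.inner_def]
  have h1 : ∫ t : ℝ, inner ℝ (translates (fun i => (memLp_Phi hn i).toLp (Phi n i)) k t)
      (translates (fun i => (memLp_Phi hn i).toLp (Phi n i)) k' t) =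
      ∫ t : ℝ, Phi n k.1 (t - k.2) * Phi n k'.1 (t - k'.2) := by
    refine integral_congr_ae ?_
    filter_upwards [translates_toLp_coeFn (memLp_Phi hn) k,
      translates_toLp_coeFn (memLp_Phi hn) k'] with t h1 h2
    rw [h1, h2]
    simp [mul_comm]
  rw [h1]
  have h2 := integral_sub_right_eq_self (μ := (volume : Measure ℝ))
    (fun t : ℝ => Phi n k.1 t * Phi n k'.1 (t - (k'.2 - k.2 : ℤ))) (k.2 : ℝ)
  have h3 : ∀ t : ℝ, t - k.2 - ((k'.2 - k.2 : ℤ) : ℝ) = t - k'.2 := fun t => by push_cast; ring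
  simp only [h3] at h2
  rw [h2, intervalIntegral.integral_of_le (by norm_num),
    setIntegral_eq_integral_of_forall_compl_eq_zero]
  intro t ht
  rw [Phi_of_one_le_abs hn, zero_mul]
  by_contra h
  have := abs_lt.1 (not_le.1 h)
  exact ht ⟨this.1, this.2.le⟩

theorem inner_translates_Phi_same {n : ℕ} (hn : 1 ≤ n) (i i' : Fin (4 * n + 1)) (j : ℤ) :
    inner ℝ (translates (fun i => (memLp_Phi hn i).toLp (Phi n i)) (i, j))
      (translates (fun i => (memLp_Phi hn i).toLp (Phi n i)) (i', j)) =
    (ip (rightPiece n i) (rightPiece n i') + ip (leftPiece n i) (leftPiece n i')) / 2 := by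
  rw [inner_translates_Phi hn]
  simp only [sub_self, Int.cast_zero, sub_zero]
  rw [add_div, add_comm, ← integral_comp_two_mul_sub_one, ← integral_comp_two_mul_add_one]
  congr 1 <;> refine intervalIntegral.integral_congr fun t ht => ?_
  · rw [Set.uIcc_of_le (by norm_num)] at ht
    simp only [Phi_of_mem_Icc_zero_one hn _ ht]
  · rw [Set.uIcc_of_le (by norm_num)] at ht
    simp only [Phi_of_mem_Icc_neg_one_zero hn _ ht]

/-- Neighbouring translates share one unit interval, where a right piece meets a left piece; this is
where `⟨q_r, q_l⟩ = 0` enters. More distant translates do not overlap. -/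
theorem inner_translates_Phi_of_lt {n : ℕ} (hn : 1 ≤ n) (i i' : Fin (4 * n + 1)) {j j' : ℤ}
    (hj : j < j') :
    inner ℝ (translates (fun i => (memLp_Phi hn i).toLp (Phi n i)) (i, j))
      (translates (fun i => (memLp_Phi hn i).toLp (Phi n i)) (i', j')) = 0 := by
  rw [inner_translates_Phi hn]
  have hd : (1 : ℝ) ≤ ((j' - j : ℤ) : ℝ) := by exact_mod_cast (by omega : 1 ≤ j' - j)
  have h1 : ∫ t in (-1 : ℝ)..0, Phi n i t * Phi n i' (t - (j' - j : ℤ)) = 0 := by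
    refine (intervalIntegral.integral_congr fun t ht => ?_).trans intervalIntegral.integral_zero
    rw [Set.uIcc_of_le (by norm_num)] at ht
    rw [Phi_of_one_le_abs hn i', mul_zero]
    rw [le_abs]; right; linarith [ht.2]
  simp only [h1, zero_add]
  rcases (by omega : j' - j = 1 ∨ 2 ≤ j' - j) with h | h
  · have h2 : ip (rightPiece n i) (leftPiece n i') / 2 = 0 := by
      rw [ip_comm, ip_leftPiece_rightPiece hn (Nat.lt_succ_iff.1 i.2), zero_div]
    rw [← integral_comp_two_mul_sub_one] at h2
    rw [h]
    refine (intervalIntegral.integral_congr fun t ht => ?_).trans h2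
    rw [Set.uIcc_of_le (by norm_num)] at ht
    simp only [Int.cast_one]
    rw [Phi_of_mem_Icc_zero_one hn _ ht,
      Phi_of_mem_Icc_neg_one_zero hn _ ⟨by linarith [ht.1], by linarith [ht.2]⟩]
    congr 2
    ring
  · have hd : (2 : ℝ) ≤ ((j' - j : ℤ) : ℝ) := by exact_mod_cast h
    refine (intervalIntegral.integral_congr fun t ht => ?_).trans intervalIntegral.integral_zero
    rw [Set.uIcc_of_le (by norm_num)] at ht
    rw [Phi_of_one_le_abs hn i', mul_zero]
    rw [le_abs]; right; linarith [ht.2]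

theorem pairwise_inner_translates_Phi {n : ℕ} (hn : 1 ≤ n) :
    Pairwise fun k k' =>
      inner ℝ (translates (fun i => (memLp_Phi hn i).toLp (Phi n i)) k)
        (translates (fun i => (memLp_Phi hn i).toLp (Phi n i)) k') = 0 := by
  rintro ⟨i, j⟩ ⟨i', j'⟩ hk
  rcases lt_trichotomy j j' with h | rfl | h
  · exact inner_translates_Phi_of_lt hn i i' h
  · have hi : (i : ℕ) ≠ i' := fun h => hk (by rw [Fin.ext h])
    rw [inner_translates_Phi_same hn, ip_rightPiece_add_leftPiece hn hi (Nat.lt_succ_iff.1 i.2)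
      (Nat.lt_succ_iff.1 i'.2), zero_div]
  · rw [real_inner_comm]
    exact inner_translates_Phi_of_lt hn i' i h

theorem toLp_Phi_ne_zero {n : ℕ} (hn : 1 ≤ n) (i : Fin (4 * n + 1)) :
    (memLp_Phi hn i).toLp (Phi n i) ≠ 0 := by
  intro h
  have h1 := inner_translates_Phi_same hn i i 0
  have h2 := norm_translates (fun i => (memLp_Phi hn i).toLp (Phi n i)) (i, 0)
  simp only [h, norm_zero] at h2
  rw [real_inner_self_eq_norm_sq, h2] at h1
  have h3 := ip_rightPiece_self_pos hn i
  have h4 := ip_self_nonneg (leftPiece n i)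
  norm_num at h1
  linarith

/-! ### Splines as series of generators -/

theorem sum_range_eq_add_Icc {N : ℕ} (hN : 1 ≤ N) (f : ℕ → ℝ) :
    ∑ j ∈ Finset.range (N + 1), f j = f 0 + f 1 + ∑ j ∈ Finset.Icc 2 N, f j := by
  rw [Finset.range_eq_Ico, Finset.sum_eq_sum_Ico_succ_bot (by omega),
    Finset.sum_eq_sum_Ico_succ_bot (by omega), ← add_assoc]
  congr 1

/-- A polynomial of degree at most `4 n` is on `[-1,1]` a combination of the pieces of the
generators. -/
theorem exists_eval_eq_pieces {n : ℕ} (hn : 1 ≤ n) {P : ℝ[X]} (hP : P.natDegree ≤ 4 * n) :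
    ∃ a : ℕ → ℝ, a 0 = P.eval (-1) / 2 ∧ ∀ x ∈ Set.Icc (-1 : ℝ) 1,
      P.eval x = ∑ i : Fin (4 * n + 1), a i * rightPiece n i x +
        P.eval 1 / 2 * qR (4 * n) (wave n) x := by
  set B := projPoly (4 * n) (fun t => 1 + t) with hB
  have hBm : B ∈ bubbleSpace (4 * n) := projPoly_mem _ _
  set c := ip (wave n) (rampR (4 * n)) / ip (wave n) (wave n) with hc
  set α := P.eval (-1) / 2 with hα
  set β := P.eval 1 / 2 with hβ
  -- `P` minus its linear interpolant at `±1`, so that `R` vanishes there.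
  set R : ℝ[X] := P - C α * (1 - X) - C β * (1 + X) with hR
  have hRm : R ∈ bubbleSpace (4 * n) := by
    have h1 : (1 - X : ℝ[X]).natDegree ≤ 4 * n :=
      (natDegree_sub_le _ _).trans (max_le (by simp) (natDegree_X_le.trans (by omega)))
    have h2 : (1 + X : ℝ[X]).natDegree ≤ 4 * n :=
      (natDegree_add_le _ _).trans (max_le (by simp) (natDegree_X_le.trans (by omega)))
    refine ⟨(natDegree_sub_le _ _).trans (max_le ((natDegree_sub_le _ _).trans (max_le hP ?_)) ?_),
      ?_, ?_⟩
    · exact (natDegree_C_mul_le _ _).trans h1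
    · exact (natDegree_C_mul_le _ _).trans h2
    · simp [hR, hα, hβ]; ring
    · simp [hR, hα, hβ]; ring
  have hS : R + α • B.comp (-X) + β • B ∈ bubbleSpace (4 * n) :=
    Submodule.add_mem _ (Submodule.add_mem _ hRm
      (Submodule.smul_mem _ _ (comp_neg_mem_bubbleSpace hBm))) (Submodule.smul_mem _ _ hBm)
  obtain ⟨b, hb⟩ := exists_eq_sum_bubble (by omega) hS
  -- With `1 + x = q_r + B(x) + c w` and `1 - x = q_l + B(-x) - c w`, the interpolant contributes `c
  -- (β - α)` to the coefficient of `w`, and its polynomial remainder is absorbed in the bubbles.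
  set a : ℕ → ℝ := fun j => if j = 0 then α else if j = 1 then c * (β - α) else b j with ha
  refine ⟨a, rfl, fun x hx => ?_⟩
  rw [Fin.sum_univ_eq_sum_range (fun j => a j * rightPiece n j x), sum_range_eq_add_Icc (by omega)]
  have hsum : ∑ j ∈ Finset.Icc 2 (4 * n), a j * rightPiece n j x =
      (R + α • B.comp (-X) + β • B).eval x := by
    rw [hb x]
    refine Finset.sum_congr rfl fun j hj => ?_
    have hj' := (Finset.mem_Icc.1 hj).1
    simp only [ha]
    rw [rightPiece_of_two_le hj', if_neg (by omega), if_neg (by omega)]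
  have hqR : qR (4 * n) (wave n) x = 1 + x - B.eval x - c * wave n x := by
    rw [qR, rampR_eq]
  have hqL : qL (4 * n) (wave n) x = 1 - x - B.eval (-x) + c * wave n x := by
    rw [qL, qR, rampR_eq, wave_neg hn hx]
    ring
  rw [hsum]
  simp only [ha, if_true, one_ne_zero, if_false, rightPiece_zero, rightPiece_one]
  rw [hqR, hqL]
  simp [hR]
  ring

/-- On each unit interval the spline is a combination of pieces in which `q_l` and `q_r` carry half
the values at the left and right ends. Adjacent intervals share the value at their common node, so
these coefficients fit together into one for each translate of the symmetric generator. -/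
theorem splineSpace₀_subset_V₀ {n : ℕ} (hn : 1 ≤ n) :
    splineSpace₀ (4 * n) ⊆ V₀ (fun i => (memLp_Phi hn i).toLp (Phi n i)) := by
  rintro f ⟨s, -, hs, hfs⟩
  choose P hPd hP using hs
  -- The piece on `[k, k+1]`, transported to `[-1,1]` by `t = (x + 1)/2 + k`.
  set Q : ℤ → ℝ[X] := fun k => (P k).comp (C 2⁻¹ * X + C (2⁻¹ + (k : ℝ))) with hQ
  have hQd : ∀ k, (Q k).natDegree ≤ 4 * n := by
    intro k
    have h1 : (C (2⁻¹ : ℝ) * X + C (2⁻¹ + (k : ℝ))).natDegree ≤ 1 := by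
      refine (natDegree_add_le _ _).trans (max_le ?_ (by simp))
      exact (natDegree_C_mul_le _ _).trans natDegree_X_le
    exact natDegree_comp_le.trans ((Nat.mul_le_mul (hPd k) h1).trans (mul_one _).le)
  have hQe : ∀ (k : ℤ) (t : ℝ), (Q k).eval (2 * (t - k) - 1) = (P k).eval t := by
    intro k t
    simp only [hQ, eval_comp, eval_add, eval_mul, eval_C, eval_X]
    congr 1
    ring
  choose a ha0 ha using fun k => exists_eval_eq_pieces hn (hQd k)
  have hleft : ∀ k : ℤ, a k 0 = s k / 2 := by
    intro k
    rw [ha0, hP k k ⟨le_rfl, by linarith⟩, ← hQe]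
    norm_num
  have hright : ∀ k : ℤ, (Q k).eval 1 = s (k + 1) := by
    intro k
    rw [hP k (k + 1) ⟨by linarith, le_rfl⟩, ← hQe]
    congr 1
    ring
  refine mem_V₀_of_ae_eq_series (memLp_Phi hn) (Phi_of_one_le_abs hn) (toLp_Phi_ne_zero hn)
    (pairwise_inner_translates_Phi hn) (b := fun q => a q.2 q.1) ?_
  filter_upwards [hfs] with t ht
  set k : ℤ := ⌊t⌋
  have htk : t ∈ Set.Icc (k : ℝ) (k + 1) := ⟨Int.floor_le t, (Int.lt_floor_add_one t).le⟩
  rw [ht, hP k t htk, ← hQe, ha k _ ⟨by linarith [htk.1], by linarith [htk.2]⟩, hright,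
    series_eq_sum (Phi_of_one_le_abs hn) _ {k, k + 1}
      (fun j hj => one_le_abs_sub_of_mem_Icc htk hj), Finset.sum_product]
  have hpair : ∀ i : Fin (4 * n + 1), ∑ j ∈ ({k, k + 1} : Finset ℤ), a j i * Phi n i (t - j) =
      a k i * rightPiece n i (2 * (t - k) - 1) +
        a (k + 1) i * leftPiece n i (2 * (t - k) - 1) := by
    intro i
    rw [Finset.sum_pair (by omega), Phi_of_mem_Icc_zero_one hn i
      ⟨by linarith [htk.1], by linarith [htk.2]⟩, Phi_of_mem_Icc_neg_one_zero hn i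
      ⟨by push_cast; linarith [htk.1], by push_cast; linarith [htk.2]⟩]
    congr 3
    push_cast
    ring
  simp only [hpair]
  -- Among the translates by `k + 1`, only that of the generator of index 0 reaches into `[k, k+1]`.
  rw [Finset.sum_add_distrib, Finset.sum_eq_single (0 : Fin (4 * n + 1)) (s := Finset.univ)
    (f := fun i : Fin (4 * n + 1) => a (k + 1) i * leftPiece n i (2 * (t - k) - 1))]
  · have := hleft (k + 1)
    push_cast at this
    rw [Fin.val_zero, leftPiece_zero, this]
  · intro i _ hi
    rw [leftPiece_of_ne (fun h => hi (Fin.ext h)), mul_zero]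
  · simp

theorem V₀_Phi_subset {n : ℕ} (hn : 1 ≤ n) :
    (V₀ (fun i => (memLp_Phi hn i).toLp (Phi n i)) : Set L2R) ⊆
      dilate 1 (splineSpace₀ (4 * n)) :=
  V₀_subset_dilate_splineSpace₀ (memLp_Phi hn) (continuous_Phi hn) (Phi_of_one_le_abs hn)
    (toLp_Phi_ne_zero hn) (pairwise_inner_translates_Phi hn) fun i k =>
      let ⟨P, _, hd, h⟩ := exists_ratPoly_eq_Phi hn i k
      ⟨P, hd, h⟩

end SplineMRA

end

open SplineMRA
theorem mainTheorem1 (n : ℕ) (hn : 1 ≤ n) :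
    ∃ hΦ : ∀ i, MeasureTheory.MemLp (Phi n i) 2 MeasureTheory.volume,
      -- the generators are compactly supported and generate an orthogonal MRA
      (∀ i, HasCompactSupport (Phi n i)) ∧
      IsOrthogonalMRA (fun i => (hΦ i).toLp (Phi n i)) ∧
      -- which is intertwined with the continuous spline spaces of degree `4n`
      (∀ p : ℤ, splineSpace (4 * n) p ⊆ V (fun i => (hΦ i).toLp (Phi n i)) p ∧
        V (fun i => (hΦ i).toLp (Phi n i)) p ⊆ splineSpace (4 * n) (p + 1)) ∧
      -- `φ̃_0` is symmetric
      (∀ t : ℝ, Phi n 0 (-t) = Phi n 0 t) ∧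
      -- the generators are piecewise polynomials with rational coefficients
      (∀ i, ∀ k : ℤ, ∃ P : Polynomial ℚ, P.natDegree ≤ 4 * n ∧
        ∀ t ∈ Set.Icc ((k : ℝ) / 2) (((k : ℝ) + 1) / 2), Phi n i t = Polynomial.aeval t P) ∧
      -- `α_{0,n}(4n) = 0`, and then `w^0_{4n,0,n} = u^0_{4n,2n}`
      IsIntertwiningCoeff (4 * n) 0 n 0 ∧
      wGen (4 * n) 0 n 0 = u (4 * n) (2 * n) := by
  obtain ⟨hmra, hmem⟩ := isOrthogonalMRA_of_intertwined (memLp_Phi hn) (toLp_Phi_ne_zero hn)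
    (pairwise_inner_translates_Phi hn) (splineSpace₀_subset_V₀ hn) (V₀_Phi_subset hn)
  exact ⟨memLp_Phi hn, hasCompactSupport_Phi hn, hmra, hmem, Phi_zero_neg hn,
    exists_rat_polynomial_eq_Phi hn, isIntertwiningCoeff_zero hn, wGen_zero n⟩
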